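/- Let $d\ge 1$. For a finite set $S$ of points in general position in $\mathbb{R}^d$ (any at most $d+1$ of its points are affinely independent), a \emph{$k$-facet} of $S$ is an oriented $(d-1)$-simplex spanned by $d$ points of $S$ that has exactly $k$ points of $S$ in the positive (open) side of its affine hull; the two orientations of a simplex are counted separately. Let $e_k(S)$ be the number of $k$-facets of $S$ and $E_k(S)=\sum_{j=0}^{k}e_j(S)$ the number of $(\le k)$-facets. Let $n\ge d+1$. Every set $S$ of $n$ points in general position in $\mathbb{R}^d$ satisfies $$E_k(S)\ \ge\ (d+1)\binom{k+d}{d}\qquad\text{for all integers } 0\le k<\Big\lfloor\frac{n}{d+1}\Big\rfloor .$$ Moreover, the bound is tight in the whole range of $k$: for every $d\ge 1$ and $n\ge d+1$ there is a set $S$ of $n$ points in general position in $\mathbb{R}^d$ with $E_k(S)=(d+1)\binom{k+d}{d}$ for all integers $0\le k<\lfloor n/(d+1)\rfloor$. -/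

import Mathlib

/-- A finite set of points of `ℝ^d` is in general position if any at most `d + 1` of its points are
affinely independent; for sets of at least `d + 1` points this says that no `d + 1` of them lie on
a common hyperplane. -/
def GeneralPosition {d : ℕ} (S : Finset (EuclideanSpace ℝ (Fin d))) : Prop :=
  ∀ T : Finset (EuclideanSpace ℝ (Fin d)), T ⊆ S → T.card ≤ d + 1 →
    AffineIndependent ℝ (fun p : T => (p : EuclideanSpace ℝ (Fin d)))

/-- `u` is a unit normal of the affine hull of `σ`. If `σ` consists of `d` affinely independent
points of `ℝ^d`, `d ≥ 1`, there are exactly two such `u`, and choosing one of them is the same as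
choosing an orientation of the simplex with vertex set `σ`. -/
def IsUnitNormal {d : ℕ} (σ : Finset (EuclideanSpace ℝ (Fin d))) (u : EuclideanSpace ℝ (Fin d)) :
    Prop :=
  ‖u‖ = 1 ∧ ∀ x ∈ σ, ∀ y ∈ σ, inner ℝ u (y - x) = 0

/-- The positive side of the affine hull of `σ`, oriented by the unit normal `u`: the open
half-space bounded by this hyperplane into which `u` points. -/
def positiveSide {d : ℕ} (σ : Finset (EuclideanSpace ℝ (Fin d))) (u : EuclideanSpace ℝ (Fin d)) :
    Set (EuclideanSpace ℝ (Fin d)) :=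
  {p | ∀ x ∈ σ, 0 < inner ℝ u (p - x)}

/-- The set of `k`-facets of `S`: oriented simplices `(σ, u)` spanned by `d` points of `S`, with
exactly `k` points of `S` in the positive side of their affine hull. -/
def kFacets {d : ℕ} (S : Finset (EuclideanSpace ℝ (Fin d))) (k : ℕ) :
    Set (Finset (EuclideanSpace ℝ (Fin d)) × EuclideanSpace ℝ (Fin d)) :=
  {F | F.1 ⊆ S ∧ F.1.card = d ∧ IsUnitNormal F.1 F.2 ∧
    ((S : Set (EuclideanSpace ℝ (Fin d))) ∩ positiveSide F.1 F.2).ncard = k}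

/-- The number `e_k(S)` of `k`-facets of `S`. -/
noncomputable def numFacets {d : ℕ} (S : Finset (EuclideanSpace ℝ (Fin d))) (k : ℕ) : ℕ :=
  (kFacets S k).ncard

/-- The number `E_k(S) = ∑_{j = 0}^{k} e_j(S)` of `(≤ k)`-facets of `S`. -/
noncomputable def numFacetsLE {d : ℕ} (S : Finset (EuclideanSpace ℝ (Fin d))) (k : ℕ) : ℕ :=
  ∑ j ∈ Finset.range (k + 1), numFacets S j

/-!
# The number of `(≤ k)`-facets of a point set

*Lower bound.* By Helly's theorem a set `S` of `n ≥ (d + 1) (k + 1)` points has a deep centre `c`: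
it stays inside the convex hull whichever `k` points are removed (`exists_deep_center`). Only facets
oriented away from `c` are counted, that is, functionals `f` on `ℝ^d × ℝ` with `f (c, 1) = -1` which
vanish at `d` lifted points `(p, 1)`. For an extreme point `q` of `S` they contain three disjoint
families:

* the facets through `q`, which are the `(≤ k)`-facets of a configuration of dimension `d - 1`;
* the `(≤ k - 1)`-facets of `S \ {q}`, for which `q` adds at most one point to the positive side;
* the facets with exactly `k` points on the positive side that are crossed by the ray from `c` in the
  direction opposite to `q`. They have `q` on the negative side, and there are exactly
  `(k + d - 1).choose (d - 1)` of them (`IsDeep.card_exit_eq`).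

The inequality follows by induction on the dimension and on `k` (`IsDeep.le_card_facetsLE`), since
`d * (k+d-1).choose (d-1) + (d+1) * (k+d-1).choose d + (k+d-1).choose (d-1) = (d+1) * (k+d).choose d`.
To avoid quotient spaces, the points that the facets have to contain are collected in a set `R` that
grows during the induction, and the ambient space stays the same.

The third family is counted by linear programming: for every set `T` of at most `k` points other than
`q` there is exactly one simplex which the ray crosses when it leaves the points outside `T`, namely
the optimum of a bounded linear program in general position (`exists_optimal_exit`,
`eq_of_optimal_exit`). Double counting then determines how many simplices have `j` points above them,
for every `j ≤ k` (`card_bases_violating`).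

*Tightness.* Put the points on `d + 1` rays from the origin whose directions sum to zero, in an equal
number up to rounding. A hyperplane through `d` of the points that does not have a whole ray on its
positive side meets each ray at most once, has the origin on its negative side, and has all points
further out on these rays on its positive side. By compactness of the sphere of normal vectors this
persists under a small perturbation (`eventually_manyAboveOrTransversal`), which can be chosen to
produce general position (`eventually_affineIndependent`). So a `(≤ k)`-facet is determined by the ray
that it misses and by `d` natural numbers with sum at most `k` (`card_transversals_le`).
-/

open Module MeasureTheory Topology

/-! ### Linear programs in general position -/

theorem LinearIndepOn.exists_functional {κ W : Type*} [AddCommGroup W] [Module ℝ W]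
    [FiniteDimensional ℝ W] {w : κ → W} {B : Finset κ} (hB : LinearIndepOn ℝ w (B : Set κ))
    (hc : B.card = finrank ℝ W) (g : κ → ℝ) : ∃ f : W →ₗ[ℝ] ℝ, ∀ i ∈ B, f (w i) = g i := by
  let b : Basis B ℝ W := Basis.mk hB.linearIndependent
    (hB.linearIndependent.span_eq_top_of_card_eq_finrank' (by simpa using hc)).ge
  refine ⟨b.constr ℝ (fun i => g i), fun i hi => ?_⟩
  have := b.constr_basis ℝ (fun i => g i) ⟨i, hi⟩
  simpa [b] using this

theorem LinearIndepOn.exists_coeff {κ W : Type*} [AddCommGroup W] [Module ℝ W]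
    [FiniteDimensional ℝ W] {w : κ → W} {B : Finset κ} (hB : LinearIndepOn ℝ w (B : Set κ))
    (hc : B.card = finrank ℝ W) (x : W) : ∃ a : κ → ℝ, x = ∑ i ∈ B, a i • w i := by
  classical
  let b : Basis B ℝ W := Basis.mk hB.linearIndependent
    (hB.linearIndependent.span_eq_top_of_card_eq_finrank' (by simpa using hc)).ge
  refine ⟨fun i => if h : i ∈ B then b.repr x ⟨i, h⟩ else 0, ?_⟩
  rw [← Finset.sum_coe_sort]
  conv_lhs => rw [← b.sum_repr x]
  refine Finset.sum_congr rfl fun i _ => ?_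
  simp [b]

theorem LinearIndepOn.functional_ext {κ W : Type*} [AddCommGroup W] [Module ℝ W]
    [FiniteDimensional ℝ W] {w : κ → W} {B : Finset κ} (hB : LinearIndepOn ℝ w (B : Set κ))
    (hc : B.card = finrank ℝ W) {f g : W →ₗ[ℝ] ℝ} (h : ∀ i ∈ B, f (w i) = g (w i)) : f = g := by
  ext x
  obtain ⟨a, rfl⟩ := hB.exists_coeff hc x
  simp only [map_sum, map_smul]
  exact Finset.sum_congr rfl fun i hi => by rw [h i hi]

/-- The ratio test of the simplex method: moving from `a ≥ 0` in the direction `-l` until the first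
coordinate vanishes. -/
theorem exists_ratio_test {κ : Type*} {σ : Finset κ} {a l : κ → ℝ} (ha : ∀ i ∈ σ, 0 ≤ a i)
    (hl : ∃ i ∈ σ, 0 < l i) :
    ∃ t : ℝ, 0 ≤ t ∧ ∃ i ∈ σ, 0 < l i ∧ a i = t * l i ∧ ∀ j ∈ σ, 0 ≤ a j - t * l j := by
  classical
  have hne : (σ.filter (fun i => 0 < l i)).Nonempty := by
    obtain ⟨i, hi, h⟩ := hl
    exact ⟨i, by simp [hi, h]⟩
  obtain ⟨i, hi, hmin⟩ := Finset.exists_min_image _ (fun i => a i / l i) hne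
  rw [Finset.mem_filter] at hi
  have ht : 0 ≤ a i / l i := div_nonneg (ha i hi.1) hi.2.le
  refine ⟨a i / l i, ht, i, hi.1, hi.2, (div_mul_cancel₀ _ hi.2.ne').symm, fun j hj => ?_⟩
  rcases le_or_gt (l j) 0 with h | h
  · have := mul_nonpos_of_nonneg_of_nonpos ht h
    linarith [ha j hj]
  · have := hmin j (by simp [hj, h])
    rw [le_div_iff₀ h] at this
    linarith

/-- A functional that takes the value `-1` at the centre `c` and vanishes at all other vectors
indexed by `R`. With `R = {c}` and `w` the lift of points to height one these are the oriented
affine hyperplanes that have the centre strictly on their negative side; a larger `R` prescribes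
points that the hyperplane has to pass through. -/
def IsNormalized {κ W : Type*} [AddCommGroup W] [Module ℝ W] (w : κ → W) (c : κ) (R : Finset κ)
    (f : W →ₗ[ℝ] ℝ) : Prop :=
  f (w c) = -1 ∧ ∀ i ∈ R, i ≠ c → f (w i) = 0

/-- `IsExit w R q σ`: the vector `-w q` lies in the interior of the simplicial cone over `σ`, modulo
the span of `R`. When `c ∈ R`, this says that the ray which leaves the centre `c` in the direction
opposite to `q` crosses the simplex `σ`. -/
def IsExit {κ W : Type*} [AddCommGroup W] [Module ℝ W] (w : κ → W) (R : Finset κ) (q : κ)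
    (σ : Finset κ) : Prop :=
  ∃ a : κ → ℝ, (∀ i ∈ σ, 0 < a i) ∧ -w q = ∑ i ∈ σ, a i • w i + ∑ i ∈ R, a i • w i

section Optimum

variable {κ W : Type*} [AddCommGroup W] [Module ℝ W] {w : κ → W} {c : κ}
  {R : Finset κ}

theorem IsNormalized.map_sum {f : W →ₗ[ℝ] ℝ} (hf : IsNormalized w c R f) (hc : c ∈ R)
    (a : κ → ℝ) : f (∑ i ∈ R, a i • w i) = -a c := by
  rw [_root_.map_sum, Finset.sum_eq_single_of_mem c hc]
  · simp [hf.1]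
  · intro i hi hic
    simp [hf.2 i hi hic]

/-- Weak duality: the value at `q` of a normalized functional is determined by its values on `σ`. -/
theorem IsNormalized.map_of_exit {f : W →ₗ[ℝ] ℝ} (hf : IsNormalized w c R f) (hc : c ∈ R) {q : κ}
    {σ : Finset κ} {a : κ → ℝ} (h : -w q = ∑ i ∈ σ, a i • w i + ∑ i ∈ R, a i • w i) :
    f (w q) = a c - ∑ i ∈ σ, a i * f (w i) := by
  have := congrArg f h
  rw [map_add, hf.map_sum hc, map_neg, _root_.map_sum] at this
  simp only [map_smul, smul_eq_mul] at this
  linarith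

variable [DecidableEq κ]

/-- In general position, a nonnegative representation of `-w q` over a basis is a positive one. -/
theorem coeff_pos_of_exit {s : ℕ} {q : κ} {σ : Finset κ} (hs : R.card + s = finrank ℝ W)
    (hRσ : Disjoint R σ) (hσ : σ.card = s) (hqR : q ∉ R) (hqσ : q ∉ σ)
    (hind : ∀ B ⊆ insert q (R ∪ σ), B.card ≤ finrank ℝ W → LinearIndepOn ℝ w (B : Set κ))
    {a : κ → ℝ} (ha : ∀ i ∈ σ, 0 ≤ a i)
    (h : -w q = ∑ i ∈ σ, a i • w i + ∑ i ∈ R, a i • w i) : ∀ i ∈ σ, 0 < a i := by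
  intro j hj
  refine (ha j hj).lt_of_ne fun h0 => ?_
  have hq : q ∉ R ∪ σ.erase j := by grind
  have hd : Disjoint R (σ.erase j) := hRσ.mono_right (Finset.erase_subset _ _)
  have hI' := hind (insert q (R ∪ σ.erase j)) (by grind) (by
    rw [Finset.card_insert_of_notMem hq, Finset.card_union_of_disjoint hd,
      Finset.card_erase_of_mem hj]
    have := Finset.card_pos.2 ⟨j, hj⟩
    omega)
  have := linearIndepOn_finset_iff.1 hI' (fun i => if i = q then 1 else a i) (by
    rw [Finset.sum_insert hq, Finset.sum_congr rfl (g := fun i => a i • w i)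
      (fun i hi => by rw [if_neg (by rintro rfl; exact hq hi)]), Finset.sum_union hd,
      Finset.sum_erase _ (by rw [← h0, zero_smul]), add_comm (∑ i ∈ R, _), ← h]
    simp) q (by simp)
  simp at this

variable [FiniteDimensional ℝ W]

/-- Carathéodory's theorem for cones, modulo the span of `R` and in general position. -/
theorem exists_exit {s : ℕ} {X : Finset κ} {q : κ} (hs : R.card + s = finrank ℝ W)
    (hRX : Disjoint R X) (hqR : q ∉ R) (hqX : q ∉ X)
    (hind : ∀ B ⊆ insert q (R ∪ X), B.card ≤ finrank ℝ W → LinearIndepOn ℝ w (B : Set κ))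
    (hspan : ∃ a : κ → ℝ, (∀ i ∈ X, 0 ≤ a i) ∧
      -w q = ∑ i ∈ X, a i • w i + ∑ i ∈ R, a i • w i) :
    ∃ σ ⊆ X, σ.card = s ∧ ∃ a : κ → ℝ, (∀ i ∈ σ, 0 ≤ a i) ∧
      -w q = ∑ i ∈ σ, a i • w i + ∑ i ∈ R, a i • w i := by
  let P : Finset κ → Prop := fun σ => ∃ a : κ → ℝ, (∀ i ∈ σ, 0 ≤ a i) ∧
      -w q = ∑ i ∈ σ, a i • w i + ∑ i ∈ R, a i • w i
  classical
  obtain ⟨σ, hσ, hmin⟩ := Finset.exists_min_image (X.powerset.filter P) Finset.card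
    ⟨X, by simpa using hspan⟩
  rw [Finset.mem_filter, Finset.mem_powerset] at hσ
  obtain ⟨hσX, a, ha, hrep⟩ := hσ
  have hRσ : Disjoint R σ := hRX.mono_right hσX
  have hRind : LinearIndepOn ℝ w (R : Set κ) := hind R (by grind) (by omega)
  have hI : LinearIndepOn ℝ w ((R ∪ σ : Finset κ) : Set κ) := by
    by_contra hdep
    rw [linearIndepOn_finset_iff] at hdep
    push Not at hdep
    obtain ⟨g, hg0, j, hj, hgj⟩ := hdep
    -- up to a sign, some coefficient of the dependency is positive on `σ`
    obtain ⟨l, hl0, i, hi, hli⟩ : ∃ l : κ → ℝ, ∑ i ∈ R ∪ σ, l i • w i = 0 ∧ ∃ i ∈ σ, 0 < l i := by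
      have : ∃ i ∈ σ, g i ≠ 0 := by
        by_contra! hall
        rw [Finset.sum_union hRσ, Finset.sum_eq_zero (s := σ) (fun i hi => by simp [hall i hi]),
          add_zero] at hg0
        have := linearIndepOn_finset_iff.1 hRind g hg0
        grind
      obtain ⟨i, hi, hgi⟩ := this
      rcases lt_or_gt_of_ne hgi with h | h
      · exact ⟨fun i => -g i, by simp [hg0], i, hi, by simpa using h⟩
      · exact ⟨g, hg0, i, hi, h⟩
    obtain ⟨t, ht, i₀, hi₀, hl₀, hai₀, hnn⟩ := exists_ratio_test ha ⟨i, hi, hli⟩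
    have : P (σ.erase i₀) := by
      refine ⟨fun j => a j - t * l j, fun j hj => hnn j (Finset.mem_of_mem_erase hj), ?_⟩
      have h1 : ∑ i ∈ σ.erase i₀, (a i - t * l i) • w i = ∑ i ∈ σ, (a i - t * l i) • w i := by
        refine Finset.sum_erase _ ?_
        rw [hai₀, sub_self, zero_smul]
      rw [h1, hrep]
      simp only [sub_smul, Finset.sum_sub_distrib, mul_smul, ← Finset.smul_sum]
      rw [Finset.sum_union hRσ] at hl0
      rw [sub_add_sub_comm, ← smul_add, add_comm (∑ i ∈ σ, l i • w i), hl0]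
      simp
    have := hmin (σ.erase i₀) (by
      rw [Finset.mem_filter, Finset.mem_powerset]
      exact ⟨(Finset.erase_subset _ _).trans hσX, this⟩)
    have := Finset.card_erase_lt_of_mem hi₀
    omega
  have hcard : (R ∪ σ).card ≤ finrank ℝ W := by
    have := LinearIndependent.fintype_card_le_finrank hI.linearIndependent
    simpa using this
  rw [Finset.card_union_of_disjoint hRσ] at hcard
  have hge : ¬ σ.card < s := by
    intro hlt
    have hq : q ∉ R ∪ σ := by grind
    have hI' := hind (insert q (R ∪ σ)) (by grind) (by
      rw [Finset.card_insert_of_notMem hq, Finset.card_union_of_disjoint hRσ]; omega)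
    have := linearIndepOn_finset_iff.1 hI' (fun i => if i = q then 1 else a i) (by
      rw [Finset.sum_insert hq, Finset.sum_congr rfl (g := fun i => a i • w i)
        (fun i hi => by rw [if_neg (by rintro rfl; exact hq hi)]), Finset.sum_union hRσ,
        add_comm (∑ i ∈ R, _), ← hrep]
      simp) q (by simp)
    simp at this
  exact ⟨σ, hσX, by omega, a, ha, hrep⟩

/-- Existence of a nondegenerate optimum of the linear program "minimize `f (w q)` over the
normalized functionals `f` which are nonpositive on `X`". The vertex `σ` maximizes the dual
objective; a constraint violated at `σ` would allow a pivot step that increases it. -/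
theorem exists_optimal_exit {s : ℕ} {X : Finset κ} {q : κ} (hs : R.card + s = finrank ℝ W)
    (hcR : c ∈ R) (hRX : Disjoint R X) (hqR : q ∉ R) (hqX : q ∉ X)
    (hind : ∀ B ⊆ insert q (R ∪ X), B.card ≤ finrank ℝ W → LinearIndepOn ℝ w (B : Set κ))
    (hspan : ∃ a : κ → ℝ, (∀ i ∈ X, 0 ≤ a i) ∧
      -w q = ∑ i ∈ X, a i • w i + ∑ i ∈ R, a i • w i)
    (hfeas : ∃ f, IsNormalized w c R f ∧ ∀ i ∈ X, f (w i) ≤ 0) :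
    ∃ σ ⊆ X, σ.card = s ∧ IsExit w R q σ ∧
      ∃ f, IsNormalized w c (R ∪ σ) f ∧ ∀ i ∈ X, f (w i) ≤ 0 := by
  classical
  -- the dual objective is a function of `σ`, as the coefficients are determined by `σ`
  let D : Finset (Finset κ) := (X.powersetCard s).filter fun σ => ∃ a : κ → ℝ,
    (∀ i ∈ σ, 0 ≤ a i) ∧ -w q = ∑ i ∈ σ, a i • w i + ∑ i ∈ R, a i • w i
  have hD : ∀ σ, σ ∈ D ↔ (σ ⊆ X ∧ σ.card = s) ∧ ∃ a : κ → ℝ,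
    (∀ i ∈ σ, 0 ≤ a i) ∧ -w q = ∑ i ∈ σ, a i • w i + ∑ i ∈ R, a i • w i := by
    intro σ; simp [D, Finset.mem_powersetCard]
  have hbasis : ∀ σ ∈ D, Disjoint R σ ∧ LinearIndepOn ℝ w ((R ∪ σ : Finset κ) : Set κ) ∧
      (R ∪ σ).card = finrank ℝ W := by
    intro σ hσ
    obtain ⟨⟨hσX, hσs⟩, -⟩ := (hD σ).1 hσ
    have hd : Disjoint R σ := hRX.mono_right hσX
    have hc : (R ∪ σ).card = finrank ℝ W := by
      rw [Finset.card_union_of_disjoint hd]; omega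
    exact ⟨hd, hind _ (by grind) hc.le, hc⟩
  have hfun : ∀ σ ∈ D, ∃ f, IsNormalized w c (R ∪ σ) f := by
    intro σ hσ
    obtain ⟨-, hI, hc⟩ := hbasis σ hσ
    obtain ⟨f, hf⟩ := hI.exists_functional hc (fun i => if i = c then -1 else 0)
    exact ⟨f, by simpa using hf c (by simp [hcR]), fun i hi hic => by simpa [hic] using hf i hi⟩
  choose! F hF using hfun
  obtain ⟨σ₀, hσ₀⟩ := exists_exit hs hRX hqR hqX hind hspan
  obtain ⟨σ, hσ, hmax⟩ := Finset.exists_max_image D (fun σ => F σ (w q))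
    ⟨σ₀, (hD _).2 ⟨⟨hσ₀.1, hσ₀.2.1⟩, hσ₀.2.2⟩⟩
  have hval : ∀ τ ∈ D, ∀ a : κ → ℝ, -w q = ∑ i ∈ τ, a i • w i + ∑ i ∈ R, a i • w i →
      F τ (w q) = a c := by
    intro τ hτ a ha
    have hn : IsNormalized w c R (F τ) := ⟨(hF τ hτ).1, fun i hi => (hF τ hτ).2 i (by simp [hi])⟩
    rw [hn.map_of_exit hcR ha, Finset.sum_eq_zero, sub_zero]
    intro i hi
    have hic : i ≠ c := by
      rintro rfl
      exact Finset.disjoint_left.1 (hbasis τ hτ).1 hcR hi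
    rw [(hF τ hτ).2 i (by simp [hi]) hic, mul_zero]
  obtain ⟨⟨hσX, hσs⟩, a, ha, hrep⟩ := (hD σ).1 hσ
  obtain ⟨hRσ, hI, hcard⟩ := hbasis σ hσ
  have hpos := coeff_pos_of_exit hs hRσ hσs hqR (fun h => hqX (hσX h))
    (fun B hB => hind B (hB.trans (by grind))) ha hrep
  refine ⟨σ, hσX, hσs, ⟨a, hpos, hrep⟩, F σ, hF σ hσ, ?_⟩
  by_contra! hviol
  obtain ⟨x, hxX, hx⟩ := hviol
  have hcσ : c ∉ σ := fun h => Finset.disjoint_left.1 hRσ hcR h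
  have hxσ : x ∉ σ := by
    intro h
    have := (hF σ hσ).2 x (by simp [h]) (by rintro rfl; exact hcσ h)
    linarith
  -- express the entering vector in the current basis
  obtain ⟨l, hl⟩ := hI.exists_coeff hcard (w x)
  rw [Finset.sum_union hRσ, add_comm] at hl
  have hlc : F σ (w x) = -l c := by
    have hn : IsNormalized w c R (F σ) := ⟨(hF σ hσ).1, fun i hi => (hF σ hσ).2 i (by simp [hi])⟩
    rw [hl, map_add, hn.map_sum hcR, map_sum, Finset.sum_eq_zero, zero_add]
    intro i hi
    rw [map_smul, (hF σ hσ).2 i (by simp [hi]) (by rintro rfl; exact hcσ hi), smul_zero]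
  have hlpos : ∃ i ∈ σ, 0 < l i := by
    by_contra! hall
    obtain ⟨f₀, hf₀, hf₀X⟩ := hfeas
    have h1 : f₀ (w x) = ∑ i ∈ σ, l i * f₀ (w i) - l c := by
      conv_lhs => rw [hl, map_add, hf₀.map_sum hcR, map_sum]
      simp [sub_eq_add_neg]
    have h2 : 0 ≤ ∑ i ∈ σ, l i * f₀ (w i) :=
      Finset.sum_nonneg fun i hi => mul_nonneg_of_nonpos_of_nonpos (hall i hi) (hf₀X i (hσX hi))
    have := hf₀X x hxX
    linarith
  obtain ⟨t, ht, i₀, hi₀, hl₀, hai₀, hnn⟩ := exists_ratio_test ha hlpos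
  have htpos : 0 < t := by
    refine ht.lt_of_ne fun h => ?_
    have := hpos i₀ hi₀
    rw [hai₀, ← h, zero_mul] at this
    exact lt_irrefl _ this
  have hxR : x ∉ R := fun h => Finset.disjoint_left.1 hRX h hxX
  let b : κ → ℝ := fun i => if i = x then t else a i - t * l i
  have hb : -w q = ∑ i ∈ insert x (σ.erase i₀), b i • w i + ∑ i ∈ R, b i • w i := by
    have h1 : ∑ i ∈ R, b i • w i = ∑ i ∈ R, (a i - t * l i) • w i :=
      Finset.sum_congr rfl fun i hi => by
        simp only [b]; rw [if_neg (by rintro rfl; exact hxR hi)]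
    have h2 : ∑ i ∈ σ.erase i₀, b i • w i = ∑ i ∈ σ, (a i - t * l i) • w i := by
      rw [← Finset.sum_erase σ (a := i₀) (by rw [hai₀, sub_self, zero_smul])]
      exact Finset.sum_congr rfl fun i hi => by
        simp only [b]; rw [if_neg (by rintro rfl; exact hxσ (Finset.mem_of_mem_erase hi))]
    rw [Finset.sum_insert (fun h => hxσ (Finset.mem_of_mem_erase h)), h1, h2, hrep]
    simp only [sub_smul, Finset.sum_sub_distrib, mul_smul, ← Finset.smul_sum, b, if_true]
    conv_rhs => rw [hl]
    module
  have hmem : insert x (σ.erase i₀) ∈ D := by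
    refine (hD _).2 ⟨⟨by grind, ?_⟩, b, ?_, hb⟩
    · rw [Finset.card_insert_of_notMem (fun h => hxσ (Finset.mem_of_mem_erase h)),
        Finset.card_erase_of_mem hi₀]
      have := Finset.card_pos.2 ⟨i₀, hi₀⟩
      omega
    · intro i hi
      simp only [b]
      split_ifs with h
      · exact ht
      · exact hnn i (by grind)
  have h3 := hmax _ hmem
  rw [hval _ hmem b hb, hval σ hσ a hrep] at h3
  have hbc : b c = a c - t * l c := by
    simp only [b]; rw [if_neg (by rintro rfl; exact hxR hcR)]
  rw [hbc] at h3
  have : 0 < t * (-l c) := mul_pos htpos (by linarith)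
  linarith

/-- Uniqueness of the optimum, by complementary slackness. -/
theorem eq_of_optimal_exit {s : ℕ} {q : κ} {σ τ : Finset κ}
    (hs : R.card + s = finrank ℝ W) (hcR : c ∈ R) (hRσ : Disjoint R σ) (hRτ : Disjoint R τ)
    (hind : ∀ B ⊆ R ∪ (σ ∪ τ), B.card ≤ finrank ℝ W → LinearIndepOn ℝ w (B : Set κ))
    (hσ : σ.card = s) (hτ : τ.card = s) (hσe : IsExit w R q σ) (hτe : IsExit w R q τ)
    {f g : W →ₗ[ℝ] ℝ} (hf : IsNormalized w c (R ∪ σ) f) (hg : IsNormalized w c (R ∪ τ) g)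
    (hfτ : ∀ i ∈ τ, f (w i) ≤ 0) (hgσ : ∀ i ∈ σ, g (w i) ≤ 0) : σ = τ := by
  obtain ⟨a, ha, hra⟩ := hσe
  obtain ⟨b, hb, hrb⟩ := hτe
  have hf' : IsNormalized w c R f := ⟨hf.1, fun i hi => hf.2 i (by simp [hi])⟩
  have hg' : IsNormalized w c R g := ⟨hg.1, fun i hi => hg.2 i (by simp [hi])⟩
  have f1 := hf'.map_of_exit hcR hra
  have f2 := hf'.map_of_exit hcR hrb
  have g1 := hg'.map_of_exit hcR hra
  have g2 := hg'.map_of_exit hcR hrb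
  have z1 : ∑ i ∈ σ, a i * f (w i) = 0 := Finset.sum_eq_zero fun i hi => by
    rw [hf.2 i (by simp [hi]) (by rintro rfl; exact Finset.disjoint_left.1 hRσ hcR hi), mul_zero]
  have z2 : ∑ i ∈ τ, b i * g (w i) = 0 := Finset.sum_eq_zero fun i hi => by
    rw [hg.2 i (by simp [hi]) (by rintro rfl; exact Finset.disjoint_left.1 hRτ hcR hi), mul_zero]
  have n1 : ∀ i ∈ σ, a i * g (w i) ≤ 0 := fun i hi =>
    mul_nonpos_of_nonneg_of_nonpos (ha i hi).le (hgσ i hi)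
  have n2 : ∑ i ∈ τ, b i * f (w i) ≤ 0 := Finset.sum_nonpos fun i hi =>
    mul_nonpos_of_nonneg_of_nonpos (hb i hi).le (hfτ i hi)
  have n3 := Finset.sum_nonpos n1
  have z3 : ∑ i ∈ σ, a i * g (w i) = 0 := by linarith
  rw [Finset.sum_eq_zero_iff_of_nonpos n1] at z3
  have hsub : σ ⊆ τ := by
    intro i hi
    by_contra hiτ
    have hgi : g (w i) = 0 := (mul_eq_zero.1 (z3 i hi)).resolve_left (ha i hi).ne'
    have hic : i ≠ c := by rintro rfl; exact Finset.disjoint_left.1 hRσ hcR hi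
    have hiR : i ∉ R := fun h => Finset.disjoint_left.1 hRσ h hi
    -- `g` vanishes on a basis
    have hcR' : c ∈ R ∪ τ := by simp [hcR]
    have hcard : (insert i ((R ∪ τ).erase c)).card = finrank ℝ W := by
      rw [Finset.card_insert_of_notMem (by grind), Finset.card_erase_of_mem hcR',
        Finset.card_union_of_disjoint hRτ]
      have := Finset.card_pos.2 ⟨c, hcR⟩
      omega
    have hI := hind (insert i ((R ∪ τ).erase c)) (by grind) hcard.le
    have : g = 0 := hI.functional_ext hcard fun j hj => by
      rw [LinearMap.zero_apply]
      rcases Finset.mem_insert.1 hj with rfl | hj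
      · exact hgi
      · exact hg.2 j (Finset.mem_of_mem_erase hj) (Finset.ne_of_mem_erase hj)
    have h1 := hg.1
    rw [this] at h1
    simp at h1
  exact Finset.eq_of_subset_of_card_le hsub (by omega)

end Optimum

/-! ### Counting bases by the number of violated constraints -/

theorem sum_choose_mul_choose (s M j : ℕ) :
    ∑ z ∈ Finset.range (j + 1), (z + s).choose s * (M + (j - z)).choose M =
      (s + 1 + M + j).choose j := by
  have h : (PowerSeries.invOneSubPow ℤ (s + 1 + (M + 1))).val =
      (PowerSeries.invOneSubPow ℤ (s + 1)).val * (PowerSeries.invOneSubPow ℤ (M + 1)).val := by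
    rw [PowerSeries.invOneSubPow_add ℤ (s + 1) (M + 1), Units.val_mul]
  have h2 := congrArg (PowerSeries.coeff j) h
  rw [PowerSeries.coeff_mul, show s + 1 + (M + 1) = (s + 1 + M) + 1 by ring,
    PowerSeries.invOneSubPow_val_succ_eq_mk_add_choose,
    PowerSeries.invOneSubPow_val_succ_eq_mk_add_choose,
    PowerSeries.invOneSubPow_val_succ_eq_mk_add_choose,
    Finset.Nat.sum_antidiagonal_eq_sum_range_succ_mk] at h2
  simp only [PowerSeries.coeff_mk] at h2
  rw [← Nat.choose_symm_add]
  zify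
  rw [h2]
  refine Finset.sum_congr rfl fun z _ => ?_
  rw [add_comm z s]

theorem card_powersetCard_filter_between {κ : Type*} [DecidableEq κ] {X Z σ : Finset κ}
    (hZ : Z ⊆ X) (hσ : σ ⊆ X) (hd : Disjoint Z σ) {j : ℕ} (hj : Z.card ≤ j) :
    ((X.powersetCard j).filter fun T => Z ⊆ T ∧ Disjoint σ T).card =
      (X.card - σ.card - Z.card).choose (j - Z.card) := by
  have h1 : (X \ (σ ∪ Z)).card = X.card - σ.card - Z.card := by
    rw [Finset.card_sdiff_of_subset (Finset.union_subset hσ hZ),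
      Finset.card_union_of_disjoint hd.symm]
    omega
  rw [← h1, ← Finset.card_powersetCard]
  refine Finset.card_nbij' (fun T => T \ Z) (fun T => T ∪ Z) ?_ ?_ ?_ ?_
  · intro T hT
    simp only [Finset.coe_filter, Finset.mem_powersetCard, Set.mem_ofPred_eq, Finset.mem_coe] at hT ⊢
    obtain ⟨⟨hTX, hTj⟩, hZT, hσT⟩ := hT
    refine ⟨fun i hi => ?_, by rw [Finset.card_sdiff_of_subset hZT, hTj]⟩
    rw [Finset.disjoint_left] at hσT
    grind
  · intro T hT
    simp only [Finset.coe_filter, Finset.mem_powersetCard, Set.mem_ofPred_eq, Finset.mem_coe] at hT ⊢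
    obtain ⟨hTX, hTj⟩ := hT
    have hTZ : Disjoint T Z := by rw [Finset.disjoint_left]; grind
    refine ⟨⟨by grind, by rw [Finset.card_union_of_disjoint hTZ, hTj]; omega⟩, by grind, ?_⟩
    rw [Finset.disjoint_left] at hd ⊢
    grind
  · intro T hT
    simp only [Finset.coe_filter, Set.mem_ofPred_eq] at hT
    exact Finset.sdiff_union_of_subset hT.2.1
  · intro T hT
    simp only [Finset.mem_powersetCard, Finset.mem_coe] at hT
    ext i
    grind

/-- A counting principle of Clarkson and Mulmuley. If for every set `T` of at most `k` constraints
exactly one basis `σ` is disjoint from `T` and has its set `Z σ` of violated constraints inside `T`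
(it is the optimum after the removal of `T`), then the number of bases that violate exactly `k`
constraints is determined: double counting of the pairs `(σ, T)` gives a triangular linear system
for these numbers. -/
theorem card_bases_violating {κ : Type*} [DecidableEq κ] {X : Finset κ}
    {O : Finset (Finset κ)} {Z : Finset κ → Finset κ} {s k : ℕ}
    (hO : ∀ σ ∈ O, σ ⊆ X ∧ σ.card = s + 1) (hZ : ∀ σ ∈ O, Z σ ⊆ X ∧ Disjoint (Z σ) σ)
    (huniq : ∀ T ⊆ X, T.card ≤ k → ∃! σ, σ ∈ O ∧ Z σ ⊆ T ∧ Disjoint σ T) :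
    (O.filter fun σ => (Z σ).card = k).card = (k + s).choose s := by
  have hN : s + 1 + k ≤ X.card := by
    by_contra! hlt
    obtain ⟨T, hTX, hTc⟩ := Finset.exists_subset_card_eq (s := X) (n := min k X.card) (by simp)
    obtain ⟨σ, ⟨hσ, -, hσT⟩, -⟩ := huniq T hTX (by omega)
    have h1 := Finset.card_le_card (Finset.union_subset (hO σ hσ).1 hTX)
    rw [Finset.card_union_of_disjoint hσT, (hO σ hσ).2] at h1
    omega
  obtain ⟨M, hM⟩ := Nat.exists_eq_add_of_le hN
  let x : ℕ → ℕ := fun z => (O.filter fun σ => (Z σ).card = z).card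
  have key : ∀ j ≤ k, ∑ z ∈ Finset.range (j + 1), x z * (M + (k - j) + (j - z)).choose (j - z) =
      (X.card).choose j := by
    intro j hj
    calc ∑ z ∈ Finset.range (j + 1), x z * (M + (k - j) + (j - z)).choose (j - z)
        = ∑ z ∈ Finset.range (j + 1), ∑ σ ∈ O.filter (fun σ => (Z σ).card = z),
            ((X.powersetCard j).filter fun T => Z σ ⊆ T ∧ Disjoint σ T).card := by
          refine Finset.sum_congr rfl fun z hz => ?_
          rw [Finset.mem_range] at hz
          rw [← smul_eq_mul, ← Finset.sum_const]
          refine Finset.sum_congr rfl fun σ hσ => ?_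
          rw [Finset.mem_filter] at hσ
          rw [card_powersetCard_filter_between (hZ σ hσ.1).1 (hO σ hσ.1).1 (hZ σ hσ.1).2 (by omega),
            hσ.2, (hO σ hσ.1).2]
          congr 1
          omega
      _ = ∑ σ ∈ O, ((X.powersetCard j).filter fun T => Z σ ⊆ T ∧ Disjoint σ T).card := by
          rw [← Finset.sum_filter_add_sum_filter_not O (fun σ => (Z σ).card < j + 1),
            ← Finset.sum_fiberwise_of_maps_to (s := O.filter fun σ => (Z σ).card < j + 1)
              (t := Finset.range (j + 1)) (g := fun σ => (Z σ).card)
              (fun σ hσ => by simpa using (Finset.mem_filter.1 hσ).2),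
            Finset.sum_eq_zero (s := O.filter fun σ => ¬ (Z σ).card < j + 1), add_zero]
          · refine Finset.sum_congr rfl fun z hz => Finset.sum_congr ?_ fun _ _ => rfl
            ext σ
            simp only [Finset.mem_filter, Finset.mem_range] at hz ⊢
            grind
          · intro σ hσ
            rw [Finset.card_eq_zero, Finset.filter_eq_empty_iff]
            intro T hT hZT
            have h1 := Finset.card_le_card hZT.1
            rw [(Finset.mem_powersetCard.1 hT).2] at h1
            have h2 := (Finset.mem_filter.1 hσ).2
            omega
      _ = ∑ T ∈ X.powersetCard j, (O.filter fun σ => Z σ ⊆ T ∧ Disjoint σ T).card := by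
          simp only [Finset.card_filter]
          exact Finset.sum_comm
      _ = ∑ T ∈ X.powersetCard j, 1 := by
          refine Finset.sum_congr rfl fun T hT => ?_
          rw [Finset.mem_powersetCard] at hT
          obtain ⟨σ, hσ, hu⟩ := huniq T hT.1 (by omega)
          rw [Finset.card_eq_one]
          refine ⟨σ, ?_⟩
          ext τ
          rw [Finset.mem_filter, Finset.mem_singleton]
          exact ⟨fun h => hu τ h, fun h => h ▸ hσ⟩
      _ = (X.card).choose j := by simp
  have hx : ∀ j, j ≤ k → x j = (j + s).choose s := by
    intro j
    induction j using Nat.strong_induction_on with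
    | _ j ih =>
      intro hj
      have h1 := key j hj
      have h2 := sum_choose_mul_choose s (M + (k - j)) j
      rw [show s + 1 + (M + (k - j)) + j = X.card by omega, ← h1, Finset.sum_range_succ,
        Finset.sum_range_succ _ j] at h2
      have h3 : ∑ z ∈ Finset.range j, (z + s).choose s *
          (M + (k - j) + (j - z)).choose (M + (k - j)) =
          ∑ z ∈ Finset.range j, x z * (M + (k - j) + (j - z)).choose (j - z) := by
        refine Finset.sum_congr rfl fun z hz => ?_
        rw [Finset.mem_range] at hz
        rw [ih z hz (by omega), Nat.choose_symm_add]
      rw [h3] at h2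
      simpa using (Nat.add_left_cancel h2).symm
  exact hx k le_rfl

/-! ### Facets that leave out a deep centre -/

/-- A normalized functional vanishing on `B`, with the junk value `0` if there is none. If `B`
contains `c` and indexes a basis, it is the only one. -/
noncomputable def facetFunctional {κ W : Type*} [AddCommGroup W] [Module ℝ W] (w : κ → W) (c : κ)
    (B : Finset κ) : W →ₗ[ℝ] ℝ :=
  open Classical in if h : ∃ f, IsNormalized w c B f then h.choose else 0

/-- The members of `V` on the positive side of the hyperplane through the points of `B`, oriented
away from the centre `c`. -/
noncomputable def aboveFacet {κ W : Type*} [AddCommGroup W] [Module ℝ W] (w : κ → W) (c : κ)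
    (V B : Finset κ) : Finset κ :=
  V.filter fun i => 0 < facetFunctional w c B (w i)

/-- The simplices spanned by `s` members of `V` for which the hyperplane through `R ∪ σ`, oriented
away from the centre `c ∈ R`, has at most `k` members of `V` on its positive side. -/
noncomputable def facetsLE {κ W : Type*} [DecidableEq κ] [AddCommGroup W] [Module ℝ W] (w : κ → W)
    (c : κ) (R V : Finset κ) (s k : ℕ) : Finset (Finset κ) :=
  (V.powersetCard s).filter fun σ => (aboveFacet w c V (R ∪ σ)).card ≤ k

/-- The hypotheses under which hyperplanes through `R \ {c}` that leave out the centre `c` are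
counted. The vectors indexed by `R ∪ V` are in general position; removing `k` members of `V` does
not prevent the others from spanning everything as a cone, modulo the span of `R` (the centre is
deep); and the points of `R \ {c}` lie on a hyperplane with no member of `V` on the side away from
the centre (so that, seen from them, `V` is an ordinary point set of lower dimension). -/
structure IsDeep {κ W : Type*} [DecidableEq κ] [AddCommGroup W] [Module ℝ W] (w : κ → W) (c : κ)
    (R V : Finset κ) (k : ℕ) : Prop where
  mem : c ∈ R
  disj : Disjoint R V
  indep : ∀ B ⊆ R ∪ V, B.card ≤ finrank ℝ W → LinearIndepOn ℝ w (B : Set κ)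
  span : ∀ T ⊆ V, T.card ≤ k → ∀ x : W, ∃ a : κ → ℝ, (∀ i ∈ V \ T, 0 ≤ a i) ∧
    x = ∑ i ∈ V \ T, a i • w i + ∑ i ∈ R, a i • w i
  feas : ∃ f, IsNormalized w c R f ∧ ∀ i ∈ V, f (w i) ≤ 0

namespace IsDeep

variable {κ W : Type*} [DecidableEq κ] [AddCommGroup W] [Module ℝ W] {w : κ → W} {c : κ}
  {R V : Finset κ} {k : ℕ}

/-- Removing a point costs at most one unit of depth. -/
theorem erase {q : κ} (h : IsDeep w c R V (k + 1)) (hq : q ∈ V) : IsDeep w c R (V.erase q) k where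
  mem := h.mem
  disj := h.disj.mono_right (Finset.erase_subset _ _)
  indep B hB := h.indep B (hB.trans (by grind))
  span T hT hTk x := by
    obtain ⟨a, ha, hx⟩ := h.span (insert q T) (by grind)
      ((Finset.card_insert_le _ _).trans (by omega)) x
    have : V \ insert q T = V.erase q \ T := by grind
    rw [this] at ha hx
    exact ⟨a, ha, hx⟩
  feas := by
    obtain ⟨f, hf, hfV⟩ := h.feas
    exact ⟨f, hf, fun i hi => hfV i (Finset.mem_of_mem_erase hi)⟩

/-- Passing to the hyperplanes through an extreme point `q`. -/
theorem insert {q : κ} (h : IsDeep w c R V k) (hq : q ∈ V)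
    (hf : ∃ f, IsNormalized w c (insert q R) f ∧ ∀ i ∈ V, f (w i) ≤ 0) :
    IsDeep w c (insert q R) (V.erase q) k where
  mem := by simp [h.mem]
  disj := by
    have := h.disj
    rw [Finset.disjoint_left] at this ⊢
    grind
  indep B hB := h.indep B (hB.trans (by grind))
  span T hT hTk x := by
    obtain ⟨a, ha, hx⟩ := h.span T (hT.trans (Finset.erase_subset _ _)) hTk x
    have hqR : q ∉ R := fun h' => Finset.disjoint_left.1 h.disj h' hq
    have hqT : q ∈ V \ T := by grind
    have e : V.erase q \ T = (V \ T).erase q := by grind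
    refine ⟨a, fun i hi => ha i (by grind), ?_⟩
    rw [Finset.sum_insert hqR, e, ← add_assoc, Finset.sum_erase_add _ _ hqT]
    exact hx
  feas := by
    obtain ⟨f, hf, hfV⟩ := hf
    exact ⟨f, hf, fun i hi => hfV i (Finset.mem_of_mem_erase hi)⟩

variable [FiniteDimensional ℝ W] {s : ℕ}

theorem facetFunctional_eq (h : IsDeep w c R V k) (hs : R.card + s = finrank ℝ W) {σ : Finset κ}
    (hσV : σ ⊆ V) (hσ : σ.card = s) {f : W →ₗ[ℝ] ℝ} (hf : IsNormalized w c (R ∪ σ) f) :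
    facetFunctional w c (R ∪ σ) = f := by
  have hex : ∃ f, IsNormalized w c (R ∪ σ) f := ⟨f, hf⟩
  have hg : IsNormalized w c (R ∪ σ) (facetFunctional w c (R ∪ σ)) := by
    rw [facetFunctional, dif_pos hex]
    exact hex.choose_spec
  have hcard : (R ∪ σ).card = finrank ℝ W := by
    rw [Finset.card_union_of_disjoint (h.disj.mono_right hσV)]; omega
  refine (h.indep (R ∪ σ) (by grind) hcard.le).functional_ext hcard fun i hi => ?_
  by_cases hic : i = c
  · rw [hic, hf.1, hg.1]
  · rw [hf.2 i hi hic, hg.2 i hi hic]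

theorem isNormalized_facetFunctional (h : IsDeep w c R V k) (hs : R.card + s = finrank ℝ W)
    {σ : Finset κ} (hσV : σ ⊆ V) (hσ : σ.card = s) :
    IsNormalized w c (R ∪ σ) (facetFunctional w c (R ∪ σ)) := by
  have hcard : (R ∪ σ).card = finrank ℝ W := by
    rw [Finset.card_union_of_disjoint (h.disj.mono_right hσV)]; omega
  obtain ⟨f, hf⟩ := (h.indep (R ∪ σ) (by grind) hcard.le).exists_functional hcard
    (fun i => if i = c then -1 else 0)
  have hf' : IsNormalized w c (R ∪ σ) f :=
    ⟨by simpa using hf c (by simp [h.mem]), fun i hi hic => by simpa [hic] using hf i hi⟩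
  rw [h.facetFunctional_eq hs hσV hσ hf']
  exact hf'

/-- The ray from the centre away from `q` still leaves the remaining points through a simplex if at
most `k` points are removed. -/
theorem exists_exit_sdiff (h : IsDeep w c R V k) (hs : R.card + s = finrank ℝ W) {q : κ}
    (hq : q ∈ V) {T : Finset κ} (hT : T ⊆ V.erase q) (hTk : T.card ≤ k) :
    ∃ σ ⊆ V.erase q \ T, σ.card = s ∧ IsExit w R q σ ∧
      ∀ i ∈ V.erase q \ T, facetFunctional w c (R ∪ σ) (w i) ≤ 0 := by
  have hqR : q ∉ R := fun h' => Finset.disjoint_left.1 h.disj h' hq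
  have hqT : q ∈ V \ T := by grind
  have e : V.erase q \ T = (V \ T).erase q := by grind
  have hspan : ∃ a : κ → ℝ, (∀ i ∈ V.erase q \ T, 0 ≤ a i) ∧
      -w q = ∑ i ∈ V.erase q \ T, a i • w i + ∑ i ∈ R, a i • w i := by
    obtain ⟨a, ha, hx⟩ := h.span T (hT.trans (Finset.erase_subset _ _)) hTk (-w q)
    -- move the term of `q` to the left and rescale
    have hpos : 0 < 1 + a q := by linarith [ha q hqT]
    refine ⟨fun i => (1 + a q)⁻¹ * a i, fun i hi =>
      mul_nonneg (inv_nonneg.2 hpos.le) (ha i (by grind)), ?_⟩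
    rw [← Finset.sum_erase_add _ _ hqT, ← e] at hx
    have h1 : (1 + a q) • (-w q) = ∑ i ∈ V.erase q \ T, a i • w i + ∑ i ∈ R, a i • w i := by
      rw [add_smul, one_smul, smul_neg, hx]
      abel
    simp only [mul_smul, ← Finset.smul_sum]
    rw [← smul_add, ← h1, smul_smul, inv_mul_cancel₀ hpos.ne', one_smul]
  have hfeas : ∃ f, IsNormalized w c R f ∧ ∀ i ∈ V.erase q \ T, f (w i) ≤ 0 := by
    obtain ⟨f, hf, hfV⟩ := h.feas
    exact ⟨f, hf, fun i hi => hfV i (by grind)⟩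
  obtain ⟨σ, hσ, hσs, hex, f, hf, hfX⟩ := exists_optimal_exit hs h.mem
    (h.disj.mono_right (by grind)) hqR (by simp) (fun B hB => h.indep B (hB.trans (by grind)))
    hspan hfeas
  refine ⟨σ, hσ, hσs, hex, fun i hi => ?_⟩
  rw [h.facetFunctional_eq hs (hσ.trans (by grind)) hσs hf]
  exact hfX i hi

/-- A hyperplane crossed by the ray from the centre away from `q` does not have `q` on its positive
side: this is weak duality, applied to a functional that is nonpositive on all of `V`. -/
theorem facetFunctional_nonpos_of_exit (h : IsDeep w c R V k) (hs : R.card + s = finrank ℝ W)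
    {q : κ} {σ : Finset κ} (hσV : σ ⊆ V) (hσ : σ.card = s) (hex : IsExit w R q σ) (hq : q ∈ V) :
    facetFunctional w c (R ∪ σ) (w q) ≤ 0 := by
  have hn := h.isNormalized_facetFunctional hs hσV hσ
  obtain ⟨a, ha, hrep⟩ := hex
  obtain ⟨f, hf, hfV⟩ := h.feas
  have h1 := hf.map_of_exit h.mem hrep
  have h2 := IsNormalized.map_of_exit (f := facetFunctional w c (R ∪ σ))
    ⟨hn.1, fun i hi => hn.2 i (by simp [hi])⟩ h.mem hrep
  have h3 : ∑ i ∈ σ, a i * facetFunctional w c (R ∪ σ) (w i) = 0 :=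
    Finset.sum_eq_zero fun i hi => by
      rw [hn.2 i (by simp [hi]) (by
        rintro rfl; exact Finset.disjoint_left.1 h.disj h.mem (hσV hi)), mul_zero]
  have h4 : ∑ i ∈ σ, a i * f (w i) ≤ 0 := Finset.sum_nonpos fun i hi =>
    mul_nonpos_of_nonneg_of_nonpos (ha i hi).le (hfV i (hσV hi))
  linarith [hfV q hq]

/-- The number of `k`-facets crossed by a ray from a deep centre. -/
theorem card_exit_eq (h : IsDeep w c R V k) (hs : R.card + (s + 1) = finrank ℝ W) {q : κ}
    (hq : q ∈ V) :
    open Classical in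
    (((V.erase q).powersetCard (s + 1)).filter fun σ =>
      IsExit w R q σ ∧ (aboveFacet w c V (R ∪ σ)).card = k).card = (k + s).choose s := by
  classical
  let O := ((V.erase q).powersetCard (s + 1)).filter fun σ => IsExit w R q σ
  have hO : ∀ σ, σ ∈ O ↔ (σ ⊆ V.erase q ∧ σ.card = s + 1) ∧ IsExit w R q σ := by
    intro σ; simp [O, Finset.mem_powersetCard]
  have hsub : ∀ {σ}, σ ∈ O → σ ⊆ V := fun hσ =>
    ((hO _).1 hσ).1.1.trans (Finset.erase_subset _ _)
  have hqn : ∀ σ ∈ O, facetFunctional w c (R ∪ σ) (w q) ≤ 0 := fun σ hσ =>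
    h.facetFunctional_nonpos_of_exit hs (hsub hσ) ((hO σ).1 hσ).1.2 ((hO σ).1 hσ).2 hq
  have hnorm : ∀ σ ∈ O, IsNormalized w c (R ∪ σ) (facetFunctional w c (R ∪ σ)) := fun σ hσ =>
    h.isNormalized_facetFunctional hs (hsub hσ) ((hO σ).1 hσ).1.2
  have hcV : c ∉ V := fun h' => Finset.disjoint_left.1 h.disj h.mem h'
  rw [← Finset.filter_filter]
  refine card_bases_violating (X := V.erase q) (O := O) (fun σ hσ => ((hO σ).1 hσ).1) ?_ ?_
  · intro σ hσ
    refine ⟨fun i hi => ?_, ?_⟩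
    · rw [aboveFacet, Finset.mem_filter] at hi
      refine Finset.mem_erase.2 ⟨?_, hi.1⟩
      rintro rfl
      exact (hqn σ hσ).not_gt hi.2
    · rw [Finset.disjoint_left]
      intro i hi hiσ
      rw [aboveFacet, Finset.mem_filter] at hi
      have := (hnorm σ hσ).2 i (by simp [hiσ]) (by rintro rfl; exact hcV hi.1)
      exact hi.2.ne' this
  · intro T hT hTk
    obtain ⟨σ, hσ, hσs, hex, hopt⟩ := h.exists_exit_sdiff hs hq hT hTk
    have hσO : σ ∈ O := (hO σ).2 ⟨⟨hσ.trans Finset.sdiff_subset, hσs⟩, hex⟩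
    refine ⟨σ, ⟨hσO, fun i hi => ?_, ?_⟩, ?_⟩
    · rw [aboveFacet, Finset.mem_filter] at hi
      by_contra hiT
      by_cases hiq : i = q
      · rw [hiq] at hi
        exact (hqn σ hσO).not_gt hi.2
      · exact (hopt i (by grind)).not_gt hi.2
    · rw [Finset.disjoint_left]
      grind
    · rintro τ ⟨hτO, hτT, hτd⟩
      have hτ := (hO τ).1 hτO
      rw [Finset.disjoint_left] at hτd
      refine eq_of_optimal_exit hs h.mem (h.disj.mono_right (hsub hτO))
        (h.disj.mono_right (hsub hσO)) (fun B hB => h.indep B (hB.trans ?_)) hτ.1.2 hσs hτ.2 hex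
        (hnorm τ hτO) (hnorm σ hσO) (fun i hi => ?_) fun i hi => hopt i (by grind)
      · have := hsub hτO
        have := hsub hσO
        grind
      · by_contra! hpos
        have := @hτT i (by
          rw [aboveFacet, Finset.mem_filter]
          exact ⟨hsub hσO hi, hpos⟩)
        grind

/-- If `s` is positive, there is an extreme point: a point `q` of `V` such that some hyperplane
through `q` and the points of `R \ {c}` has no point of `V` on its positive side. -/
theorem exists_extreme (h : IsDeep w c R V k) (hs : R.card + (s + 1) = finrank ℝ W) :
    ∃ q ∈ V, ∃ f, IsNormalized w c (Insert.insert q R) f ∧ ∀ i ∈ V, f (w i) ≤ 0 := by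
  classical
  have hV : V.Nonempty := by
    rw [Finset.nonempty_iff_ne_empty]
    rintro rfl
    have hsp : Submodule.span ℝ ((R.image w : Finset W) : Set W) = ⊤ := by
      rw [eq_top_iff]
      intro x _
      obtain ⟨a, -, hx⟩ := h.span ∅ (by simp) (by simp) x
      rw [hx]
      simp only [Finset.sdiff_self, Finset.sum_empty, zero_add]
      exact Submodule.sum_mem _ fun i hi => Submodule.smul_mem _ _
        (Submodule.subset_span (by simpa using ⟨i, hi, rfl⟩))
    have h1 := finrank_span_finset_le_card (R := ℝ) (R.image w)
    rw [Set.finrank, hsp, finrank_top] at h1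
    have := Finset.card_image_le (s := R) (f := w)
    omega
  obtain ⟨p, hp⟩ := hV
  obtain ⟨σ, hσ, hσs, hex, hopt⟩ := h.exists_exit_sdiff hs hp (T := ∅) (by simp) (by simp)
  have hσV : σ ⊆ V := hσ.trans (by grind)
  obtain ⟨q, hq⟩ : σ.Nonempty := Finset.card_pos.1 (by omega)
  have hn := h.isNormalized_facetFunctional hs hσV hσs
  refine ⟨q, hσV hq, facetFunctional w c (R ∪ σ), ⟨hn.1, fun i hi => hn.2 i (by grind)⟩, ?_⟩
  intro i hi
  by_cases hip : i = p
  · rw [hip]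
    exact h.facetFunctional_nonpos_of_exit hs hσV hσs hex hp
  · exact hopt i (by grind)

/-- The lower bound. For an extreme point `q`, the facets counted fall into those through `q`
(dimension `s`), those which avoid `q` and have few points of `V \ {q}` above them, and those of
level exactly `k` which are crossed by the ray from the centre away from `q`. -/
theorem le_card_facetsLE (h : IsDeep w c R V k) (hs : R.card + s = finrank ℝ W) :
    (s + 1) * (k + s).choose s ≤ (facetsLE w c R V s k).card := by
  classical
  induction s generalizing R V k with
  | zero =>
    obtain ⟨f, hf, hfV⟩ := h.feas
    have h0 : facetFunctional w c (R ∪ ∅) = f :=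
      h.facetFunctional_eq hs (by simp) rfl (by simpa using hf)
    have : ∅ ∈ facetsLE w c R V 0 k := by
      rw [facetsLE, Finset.mem_filter, aboveFacet, h0, Finset.filter_false_of_mem]
      · simp
      · exact fun i hi => (hfV i hi).not_gt
    simpa using Finset.card_pos.2 ⟨_, this⟩
  | succ s ihs =>
    induction k using Nat.strong_induction_on generalizing V with
    | _ k ihk =>
    obtain ⟨q, hq, hqf⟩ := h.exists_extreme hs
    have hqR : q ∉ R := fun h' => Finset.disjoint_left.1 h.disj h' hq
    have hfn : ∀ f : W →ₗ[ℝ] ℝ, ∀ B, q ∈ R ∪ B → IsNormalized w c (R ∪ B) f → f (w q) = 0 :=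
      fun f B hqB hf => hf.2 q hqB (by rintro rfl; exact hqR h.mem)
    -- facets through `q`
    let A := (facetsLE w c (Insert.insert q R) (V.erase q) s k).image (Insert.insert q)
    have hA : (s + 1) * (k + s).choose s ≤ A.card := by
      rw [Finset.card_image_of_injOn]
      · exact ihs (h.insert hq hqf) (by rw [Finset.card_insert_of_notMem hqR]; omega)
      · intro σ hσ τ hτ hστ
        simp only [facetsLE, Finset.coe_filter, Finset.mem_powersetCard, Set.mem_ofPred_eq] at hσ hτ
        rw [← Finset.erase_insert (s := σ) (a := q) (by grind),
          ← Finset.erase_insert (s := τ) (a := q) (by grind), hστ]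
    -- facets that avoid `q` and have fewer than `k` other points above them
    let B := ((V.erase q).powersetCard (s + 1)).filter fun σ =>
      (aboveFacet w c (V.erase q) (R ∪ σ)).card < k
    have hB : (s + 2) * (k + s).choose (s + 1) ≤ B.card := by
      cases k with
      | zero => simp
      | succ k =>
        have := ihk k (by omega) (h.erase hq)
        simp only [facetsLE, ← Nat.lt_succ_iff (n := k)] at this
        rw [show k + 1 + s = k + (s + 1) by ring]
        exact this
    -- facets of level `k` that are crossed by the ray away from `q`
    let C := ((V.erase q).powersetCard (s + 1)).filter fun σ =>
      IsExit w R q σ ∧ (aboveFacet w c V (R ∪ σ)).card = k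
    have hC : C.card = (k + s).choose s := h.card_exit_eq hs hq
    have hAB : Disjoint A (B ∪ C) := by
      rw [Finset.disjoint_left]
      intro σ hσ hσ'
      have h1 : q ∈ σ := by
        obtain ⟨τ, -, rfl⟩ := Finset.mem_image.1 hσ
        simp
      have h2 : σ ⊆ V.erase q := by
        simp only [B, C, Finset.mem_union, Finset.mem_filter, Finset.mem_powersetCard] at hσ'
        tauto
      exact Finset.notMem_erase q V (h2 h1)
    have hBC : Disjoint B C := by
      rw [Finset.disjoint_left]
      intro σ hσ hσ'
      simp only [B, C, Finset.mem_filter, Finset.mem_powersetCard] at hσ hσ'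
      have hσV : σ ⊆ V := hσ.1.1.trans (Finset.erase_subset _ _)
      have hqn := h.facetFunctional_nonpos_of_exit hs hσV hσ.1.2 hσ'.2.1 hq
      have : aboveFacet w c (V.erase q) (R ∪ σ) = aboveFacet w c V (R ∪ σ) := by
        rw [aboveFacet, aboveFacet, Finset.filter_erase, Finset.erase_eq_of_notMem]
        simp [hqn]
      rw [this] at hσ
      omega
    have hsub : A ∪ (B ∪ C) ⊆ facetsLE w c R V (s + 1) k := by
      intro σ hσ
      rw [facetsLE, Finset.mem_filter, Finset.mem_powersetCard]
      simp only [A, B, C, facetsLE, Finset.mem_union, Finset.mem_image, Finset.mem_filter,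
        Finset.mem_powersetCard] at hσ
      rcases hσ with ⟨τ, ⟨⟨hτV, hτ⟩, hτk⟩, rfl⟩ | ⟨⟨hσV, hσ⟩, hσk⟩ | ⟨⟨hσV, hσ⟩, -, hσk⟩
      · have hins : Insert.insert q τ ⊆ V := by grind
        have hcard : (Insert.insert q τ).card = s + 1 := by
          rw [Finset.card_insert_of_notMem (by grind), hτ]
        have hn := h.isNormalized_facetFunctional hs hins hcard
        have h0 := hfn _ _ (by simp) hn
        have e : Insert.insert q R ∪ τ = R ∪ Insert.insert q τ := by grind
        rw [e] at hτk
        refine ⟨⟨hins, hcard⟩, ?_⟩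
        rw [aboveFacet, Finset.filter_erase, Finset.erase_eq_of_notMem (by
          rw [Finset.mem_filter, h0]; simp)] at hτk
        exact hτk
      · refine ⟨⟨hσV.trans (Finset.erase_subset _ _), hσ⟩, ?_⟩
        rw [aboveFacet, Finset.filter_erase] at hσk
        have := Finset.pred_card_le_card_erase (a := q)
          (s := V.filter fun i => 0 < facetFunctional w c (R ∪ σ) (w i))
        rw [aboveFacet]
        omega
      · exact ⟨⟨hσV.trans (Finset.erase_subset _ _), hσ⟩, hσk.le⟩
    calc (s + 1 + 1) * (k + (s + 1)).choose (s + 1)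
        = (s + 1) * (k + s).choose s + ((s + 2) * (k + s).choose (s + 1) + (k + s).choose s) := by
          rw [← add_assoc, Nat.choose_succ_succ]; ring
      _ ≤ A.card + (B.card + C.card) := by omega
      _ = (A ∪ (B ∪ C)).card := by
          rw [Finset.card_union_of_disjoint hAB, Finset.card_union_of_disjoint hBC]
      _ ≤ _ := Finset.card_le_card hsub

end IsDeep

/-! ### Deep centres of point sets -/

/-- The lift of a point to height one. -/
def heightOne {E : Type*} (p : E) : E × ℝ := (p, 1)

theorem linearIndepOn_heightOne {E : Type*} [AddCommGroup E] [Module ℝ E] {B : Finset E}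
    (hB : AffineIndependent ℝ (fun p : B => (p : E))) :
    LinearIndepOn ℝ (heightOne : E → E × ℝ) (B : Set E) := by
  rw [linearIndepOn_finset_iff]
  intro g hg
  have h1 := congrArg Prod.fst hg
  have h2 := congrArg Prod.snd hg
  simp only [heightOne, Prod.fst_sum, Prod.snd_sum, Prod.smul_mk, smul_eq_mul, mul_one,
    Prod.fst_zero, Prod.snd_zero] at h1 h2
  exact hB.eq_zero_of_sum_eq_zero_subtype h2 h1

theorem heightOne_notMem_span {E : Type*} [AddCommGroup E] [Module ℝ E] {B : Finset E} {c : E}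
    (hc : c ∉ affineSpan ℝ (B : Set E)) :
    heightOne c ∉ Submodule.span ℝ ((heightOne : E → E × ℝ) '' (B : Set E)) := by
  rw [Submodule.mem_span_image_finset_iff_exists_fun']
  rintro ⟨a, ha⟩
  have h1 := congrArg Prod.fst ha
  have h2 := congrArg Prod.snd ha
  simp only [heightOne, Prod.fst_sum, Prod.snd_sum, Prod.smul_mk, smul_eq_mul, mul_one] at h1 h2
  refine hc ?_
  rw [← Finset.sum_coe_sort] at h1 h2
  have := affineCombination_mem_affineSpan (k := ℝ) (s := Finset.univ) (w := fun i : B => a i) h2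
    (fun i : B => (i : E))
  rw [Finset.affineCombination_eq_linear_combination _ _ _ h2, h1] at this
  simpa using this

theorem affineSpan_ne_top_of_card_le {d : ℕ} {B : Finset (EuclideanSpace ℝ (Fin d))}
    (hB : B.card ≤ d) : affineSpan ℝ (B : Set (EuclideanSpace ℝ (Fin d))) ≠ ⊤ := by
  classical
  intro h
  rcases B.eq_empty_or_nonempty with rfl | hne
  · simp at h
  · have h1 : vectorSpan ℝ (B : Set (EuclideanSpace ℝ (Fin d))) = ⊤ := by
      rw [← direction_affineSpan, h, AffineSubspace.direction_top]
    have h2 := finrank_vectorSpan_image_finset_le ℝ (id : EuclideanSpace ℝ (Fin d) → _) B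
      (n := B.card - 1) (by have := hne.card_pos; omega)
    rw [Finset.image_id, h1, finrank_top, finrank_euclideanSpace, Fintype.card_fin] at h2
    have := hne.card_pos
    omega

/-- A version of the centerpoint theorem: a large set has a point in the interior of the convex hull
of what remains after the removal of any `k` points, by Helly's theorem. The point can be taken in
general position with respect to the set. -/
theorem exists_deep_center {d : ℕ} {S : Finset (EuclideanSpace ℝ (Fin d))} (hS : GeneralPosition S)
    {k : ℕ} (hk : (d + 1) * (k + 1) ≤ S.card) :
    ∃ c, (∀ T ⊆ S, T.card ≤ k →
        c ∈ interior (convexHull ℝ ((S : Set (EuclideanSpace ℝ (Fin d))) \ T))) ∧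
      ∀ B ⊆ S, B.card ≤ d → c ∉ affineSpan ℝ (B : Set (EuclideanSpace ℝ (Fin d))) := by
  classical
  let 𝒯 : Finset (Finset (EuclideanSpace ℝ (Fin d))) := S.powerset.filter fun T => T.card ≤ k
  let F : Finset (EuclideanSpace ℝ (Fin d)) → Set (EuclideanSpace ℝ (Fin d)) :=
    fun T => interior (convexHull ℝ ((S : Set (EuclideanSpace ℝ (Fin d))) \ T))
  have hne : (⋂ T ∈ 𝒯, F T).Nonempty := by
    refine Convex.helly_theorem' (𝕜 := ℝ) (fun T _ => (convex_convexHull ℝ _).interior) ?_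
    intro I hI hIc
    rw [finrank_euclideanSpace, Fintype.card_fin] at hIc
    -- at least `d + 1` points of `S` survive all the removals
    have h1 : (I.biUnion id).card ≤ (d + 1) * k := by
      refine (Finset.card_biUnion_le_card_mul I id k fun T hT => ?_).trans
        (Nat.mul_le_mul_right k hIc)
      exact (Finset.mem_filter.1 (hI hT)).2
    have h2 : d + 1 ≤ (S \ I.biUnion id).card := by
      have := Finset.le_card_sdiff (I.biUnion id) S
      have e : (d + 1) * (k + 1) = (d + 1) * k + (d + 1) := by ring
      omega
    obtain ⟨T, hT, hTc⟩ := Finset.exists_subset_card_eq h2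
    have h3 := hS T (hT.trans Finset.sdiff_subset) hTc.le
    have h4 : (interior (convexHull ℝ (T : Set (EuclideanSpace ℝ (Fin d))))).Nonempty := by
      rw [interior_convexHull_nonempty_iff_affineSpan_eq_top]
      have := h3.affineSpan_eq_top_iff_card_eq_finrank_add_one.2 (by simp [hTc])
      simpa using this
    refine h4.mono (Set.subset_iInter₂ fun T' hT' => interior_mono (convexHull_mono ?_))
    intro x hx
    have := Finset.mem_sdiff.1 (hT hx)
    exact ⟨this.1, fun h => this.2 (Finset.mem_biUnion.2 ⟨T', hT', h⟩)⟩
  have hopen : IsOpen (⋂ T ∈ 𝒯, F T) :=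
    𝒯.finite_toSet.isOpen_biInter fun T _ => isOpen_interior
  have hzero : volume (⋃ B ∈ S.powerset.filter (fun B => B.card ≤ d),
      (affineSpan ℝ (B : Set (EuclideanSpace ℝ (Fin d))) : Set (EuclideanSpace ℝ (Fin d)))) = 0 := by
    refine (measure_biUnion_null_iff (Finset.countable_toSet _)).2 fun B hB => ?_
    exact Measure.addHaar_affineSubspace _ _
      (affineSpan_ne_top_of_card_le (Finset.mem_filter.1 hB).2)
  obtain ⟨c, hc, hc'⟩ : ∃ c ∈ ⋂ T ∈ 𝒯, F T, c ∉ ⋃ B ∈ S.powerset.filter (fun B => B.card ≤ d),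
      (affineSpan ℝ (B : Set (EuclideanSpace ℝ (Fin d))) : Set (EuclideanSpace ℝ (Fin d))) := by
    by_contra! hall
    exact (hopen.measure_pos volume hne).ne' (measure_mono_null hall hzero)
  refine ⟨c, fun T hT hTk => ?_, fun B hB hBd hcB => hc' ?_⟩
  · exact Set.mem_iInter₂.1 hc T (by simp [𝒯, hT, hTk])
  · exact Set.mem_iUnion₂.2 ⟨B, by simp [hB, hBd], hcB⟩

theorem isDeep_heightOne {d : ℕ} (hd : 1 ≤ d) {S : Finset (EuclideanSpace ℝ (Fin d))}
    (hS : GeneralPosition S) {k : ℕ} {c : EuclideanSpace ℝ (Fin d)}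
    (hc : ∀ T ⊆ S, T.card ≤ k →
      c ∈ interior (convexHull ℝ ((S : Set (EuclideanSpace ℝ (Fin d))) \ T)))
    (hcB : ∀ B ⊆ S, B.card ≤ d → c ∉ affineSpan ℝ (B : Set (EuclideanSpace ℝ (Fin d)))) :
    open Classical in IsDeep heightOne c {c} S k := by
  classical
  have hcS : c ∉ S := fun h => hcB {c} (by simpa using h) (by simpa using hd)
    (mem_affineSpan ℝ (by simp))
  refine ⟨by simp, by simpa using hcS, ?_, ?_, ?_⟩
  · intro B hB hBc
    rw [finrank_prod, finrank_euclideanSpace, Fintype.card_fin, finrank_self] at hBc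
    by_cases hcB' : c ∈ B
    · have hsub : B.erase c ⊆ S := by
        intro i hi
        have := hB (Finset.mem_of_mem_erase hi)
        have := Finset.ne_of_mem_erase hi
        simp_all
      have hcard : (B.erase c).card ≤ d := by
        rw [Finset.card_erase_of_mem hcB']; omega
      have := (linearIndepOn_heightOne (hS _ hsub (by omega))).insert
        (heightOne_notMem_span (hcB _ hsub hcard))
      rwa [← Finset.coe_insert, Finset.insert_erase hcB'] at this
    · refine linearIndepOn_heightOne (hS B (fun i hi => ?_) hBc)
      have := hB hi
      rw [Finset.mem_union, Finset.mem_singleton] at this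
      rcases this with rfl | h
      · exact absurd hi hcB'
      · exact h
  · intro T hT hTk x
    have hint := hc T hT hTk
    -- move from the centre a little in the direction that `x` prescribes
    have hcont : Filter.Tendsto (fun ε : ℝ => c + ε • (x.1 - x.2 • c)) (nhdsWithin 0 (Set.Ioi 0))
        (nhds c) := by
      have : Continuous fun ε : ℝ => c + ε • (x.1 - x.2 • c) := by fun_prop
      have h := (this.tendsto 0).mono_left (nhdsWithin_le_nhds (s := Set.Ioi 0))
      simpa using h
    have hev := (hcont.eventually (isOpen_interior.eventually_mem hint)).and self_mem_nhdsWithin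
    obtain ⟨ε, hε, hε0⟩ := hev.exists
    have hε0 : 0 < ε := hε0
    have hε := interior_subset hε
    rw [← Finset.coe_sdiff, Finset.mem_convexHull'] at hε
    obtain ⟨a, ha, ha1, hac⟩ := hε
    refine ⟨fun i => if i = c then x.2 - ε⁻¹ else ε⁻¹ * a i, fun i hi => ?_, ?_⟩
    · have hic : i ≠ c := by rintro rfl; exact hcS (Finset.mem_sdiff.1 hi).1
      simp only [if_neg hic]
      exact mul_nonneg (inv_nonneg.2 hε0.le) (ha i hi)
    · have h1 : ∑ i ∈ S \ T, (if i = c then x.2 - ε⁻¹ else ε⁻¹ * a i) • heightOne i =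
          ε⁻¹ • ∑ i ∈ S \ T, a i • heightOne i := by
        rw [Finset.smul_sum]
        refine Finset.sum_congr rfl fun i hi => ?_
        rw [if_neg (by rintro rfl; exact hcS (Finset.mem_sdiff.1 hi).1), mul_smul]
      have h2 : ∑ i ∈ S \ T, a i • heightOne i = (c + ε • (x.1 - x.2 • c), (1 : ℝ)) := by
        ext1
        · simp [heightOne, Prod.fst_sum, hac]
        · simp [heightOne, Prod.snd_sum, ha1]
      rw [h1, h2, Finset.sum_singleton]
      beta_reduce
      rw [if_pos rfl]
      ext1
      · simp only [heightOne, Prod.fst_add, Prod.smul_fst]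
        rw [smul_add, smul_smul, inv_mul_cancel₀ hε0.ne', one_smul, sub_smul]
        abel
      · simp [heightOne]
  · exact ⟨-LinearMap.snd ℝ _ _, ⟨by simp [heightOne], by simp⟩, fun i _ => by simp [heightOne]⟩

/-! ### The lower bound for point sets -/

theorem IsUnitNormal.eq_or_eq_neg {d : ℕ} {σ : Finset (EuclideanSpace ℝ (Fin d))}
    (hσ : AffineIndependent ℝ (fun p : σ => (p : EuclideanSpace ℝ (Fin d)))) (hd : 1 ≤ d)
    (hσd : σ.card = d) {u v : EuclideanSpace ℝ (Fin d)} (hu : IsUnitNormal σ u)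
    (hv : IsUnitNormal σ v) : v = u ∨ v = -u := by
  let D := vectorSpan ℝ (σ : Set (EuclideanSpace ℝ (Fin d)))
  have hD : finrank ℝ D = d - 1 := by
    have := hσ.finrank_vectorSpan (n := d - 1) (by simp; omega)
    have e : Set.range (fun p : σ => (p : EuclideanSpace ℝ (Fin d))) = σ := Subtype.range_coe
    rwa [e] at this
  have hDo : finrank ℝ Dᗮ = 1 := by
    have := D.finrank_add_finrank_orthogonal
    rw [hD, finrank_euclideanSpace, Fintype.card_fin] at this
    omega
  have hmem : ∀ z, IsUnitNormal σ z → z ∈ Dᗮ := by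
    intro z hz
    rw [Submodule.mem_orthogonal']
    intro y hy
    induction hy using Submodule.span_induction with
    | mem y hy =>
      obtain ⟨a, ha, b, hb, rfl⟩ := Set.mem_vsub.1 hy
      exact hz.2 b hb a ha
    | zero => exact inner_zero_right _
    | add a b _ _ ha hb => rw [inner_add_right, ha, hb, add_zero]
    | smul t a _ ha => rw [inner_smul_right, ha, mul_zero]
  have hu0 : (⟨u, hmem u hu⟩ : Dᗮ) ≠ 0 := by
    intro h
    have h1 : u = 0 := congrArg Subtype.val h
    have h2 := hu.1
    rw [h1, norm_zero] at h2
    exact zero_ne_one h2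
  obtain ⟨t, ht⟩ := (finrank_eq_one_iff_of_nonzero' _ hu0).1 hDo ⟨v, hmem v hv⟩
  have ht : t • u = v := congrArg Subtype.val ht
  have hn := hv.1
  rw [← ht, norm_smul, hu.1, mul_one, Real.norm_eq_abs] at hn
  rcases eq_or_eq_neg_of_abs_eq hn with rfl | rfl
  · left; simpa using ht.symm
  · right; simpa using ht.symm

/-- The `(≤ k)`-facets of `S`. -/
def kFacetsLE {d : ℕ} (S : Finset (EuclideanSpace ℝ (Fin d))) (k : ℕ) :
    Set (Finset (EuclideanSpace ℝ (Fin d)) × EuclideanSpace ℝ (Fin d)) :=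
  {F | F.1 ⊆ S ∧ F.1.card = d ∧ IsUnitNormal F.1 F.2 ∧
    ((S : Set (EuclideanSpace ℝ (Fin d))) ∩ positiveSide F.1 F.2).ncard ≤ k}

theorem finite_kFacetsLE {d : ℕ} (hd : 1 ≤ d) {S : Finset (EuclideanSpace ℝ (Fin d))}
    (hS : GeneralPosition S) (k : ℕ) : (kFacetsLE S k).Finite := by
  classical
  have hfin : (⋃ σ ∈ S.powersetCard d, ({σ} : Set _) ×ˢ {u | IsUnitNormal σ u}).Finite := by
    refine Set.Finite.biUnion (Finset.finite_toSet _) fun σ hσ =>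
      (Set.finite_singleton σ).prod ?_
    have hσ := Finset.mem_powersetCard.1 hσ
    rcases Set.eq_empty_or_nonempty {u | IsUnitNormal σ u} with h | ⟨u, hu⟩
    · rw [h]; exact Set.finite_empty
    · exact (Set.toFinite {u, -u}).subset fun v hv =>
        IsUnitNormal.eq_or_eq_neg (hS σ hσ.1 (by omega)) hd hσ.2 hu hv
  refine hfin.subset fun F hF => ?_
  refine Set.mem_iUnion₂.2 ⟨F.1, Finset.mem_powersetCard.2 ⟨hF.1, hF.2.1⟩, ?_⟩
  exact ⟨rfl, hF.2.2.1⟩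

theorem numFacetsLE_eq_ncard {d : ℕ} (hd : 1 ≤ d) {S : Finset (EuclideanSpace ℝ (Fin d))}
    (hS : GeneralPosition S) (k : ℕ) : numFacetsLE S k = (kFacetsLE S k).ncard := by
  classical
  have hfin := finite_kFacetsLE hd hS k
  have hmaps : ∀ F ∈ hfin.toFinset,
      ((S : Set (EuclideanSpace ℝ (Fin d))) ∩ positiveSide F.1 F.2).ncard ∈
        Finset.range (k + 1) := by
    intro F hF
    rw [Set.Finite.mem_toFinset] at hF
    exact Finset.mem_range.2 (Nat.lt_succ_of_le hF.2.2.2)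
  rw [Set.ncard_eq_toFinset_card _ hfin, Finset.card_eq_sum_card_fiberwise hmaps, numFacetsLE]
  refine Finset.sum_congr rfl fun j hj => ?_
  rw [numFacets, ← Set.ncard_coe_finset]
  congr 1
  ext F
  rw [Finset.mem_range] at hj
  simp only [kFacets, kFacetsLE, Set.mem_ofPred_eq, Finset.coe_filter, Set.Finite.mem_toFinset]
  constructor
  · rintro ⟨h1, h2, h3, h4⟩
    exact ⟨⟨h1, h2, h3, by omega⟩, h4⟩
  · rintro ⟨⟨h1, h2, h3, -⟩, h4⟩
    exact ⟨h1, h2, h3, h4⟩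

/-- Every hyperplane through `d` points of `S` that leaves out the centre `c` gives a facet, oriented
away from the centre. -/
theorem card_facetsLE_le_numFacetsLE {d : ℕ} (hd : 1 ≤ d)
    {S : Finset (EuclideanSpace ℝ (Fin d))} (hS : GeneralPosition S) {k : ℕ}
    {c : EuclideanSpace ℝ (Fin d)} [DecidableEq (EuclideanSpace ℝ (Fin d))]
    (h : IsDeep heightOne c {c} S k) :
    (facetsLE heightOne c {c} S d k).card ≤ numFacetsLE S k := by
  have key : ∀ σ ∈ facetsLE heightOne c {c} S d k, ∃ u, (σ, u) ∈ kFacetsLE S k := by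
    intro σ hσ
    rw [facetsLE, Finset.mem_filter, Finset.mem_powersetCard] at hσ
    obtain ⟨⟨hσS, hσd⟩, hσk⟩ := hσ
    have hn := h.isNormalized_facetFunctional (s := d) (by simp [finrank_prod]; omega) hσS hσd
    obtain ⟨f, hf⟩ : ∃ f, f = facetFunctional heightOne c ({c} ∪ σ) := ⟨_, rfl⟩
    rw [← hf] at hn
    -- `f` is given on points of height one by its gradient `g` and a constant
    obtain ⟨g, hg⟩ : ∃ g : EuclideanSpace ℝ (Fin d),
        ∀ x y, f (heightOne y) - f (heightOne x) = inner ℝ g (y - x) := by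
      refine ⟨(InnerProductSpace.toDual ℝ _).symm (LinearMap.toContinuousLinearMap
        (f ∘ₗ LinearMap.inl ℝ _ _)), fun x y => ?_⟩
      rw [InnerProductSpace.toDual_symm_apply, ← map_sub]
      simp [heightOne]
    have hcS : c ∉ S := by simpa using h.disj
    have hσ0 : ∀ x ∈ σ, f (heightOne x) = 0 := fun x hx =>
      hn.2 x (by simp [hx]) (by rintro rfl; exact hcS (hσS hx))
    obtain ⟨x₀, hx₀⟩ : σ.Nonempty := Finset.card_pos.1 (by omega)
    have hg0 : 0 < ‖g‖ := by
      rw [norm_pos_iff]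
      rintro rfl
      have := hg c x₀
      rw [hσ0 x₀ hx₀, hn.1, inner_zero_left] at this
      norm_num at this
    refine ⟨‖g‖⁻¹ • g, hσS, hσd, ⟨?_, fun x hx y hy => ?_⟩, ?_⟩
    · rw [norm_smul, norm_inv, norm_norm, inv_mul_cancel₀ hg0.ne']
    · rw [real_inner_smul_left, ← hg, hσ0 x hx, hσ0 y hy, sub_zero, mul_zero]
    · have hpos : (S : Set (EuclideanSpace ℝ (Fin d))) ∩ positiveSide σ (‖g‖⁻¹ • g) =
          (aboveFacet heightOne c S ({c} ∪ σ) : Set (EuclideanSpace ℝ (Fin d))) := by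
        ext p
        rw [aboveFacet, Finset.coe_filter, ← hf]
        refine and_congr_right fun _ => ?_
        have e : ∀ x ∈ σ, 0 < inner ℝ (‖g‖⁻¹ • g) (p - x) ↔ 0 < f (heightOne p) := by
          intro x hx
          rw [real_inner_smul_left, ← hg, hσ0 x hx, sub_zero, mul_pos_iff_of_pos_left
            (inv_pos.2 hg0)]
        exact ⟨fun hp => (e x₀ hx₀).1 (hp x₀ hx₀), fun hp x hx => (e x hx).2 hp⟩
      simpa only [hpos, Set.ncard_coe_finset] using hσk
  choose! u hu using key
  rw [numFacetsLE_eq_ncard hd hS, ← Set.ncard_coe_finset]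
  exact Set.ncard_le_ncard_of_injOn (fun σ => (σ, u σ)) (fun σ hσ => hu σ hσ)
    (fun σ _ τ _ hστ => congrArg Prod.fst hστ) (finite_kFacetsLE hd hS k)

theorem le_numFacetsLE {d : ℕ} (hd : 1 ≤ d) {S : Finset (EuclideanSpace ℝ (Fin d))}
    (hS : GeneralPosition S) {k : ℕ} (hk : k < S.card / (d + 1)) :
    (d + 1) * (k + d).choose d ≤ numFacetsLE S k := by
  classical
  obtain ⟨c, hc, hcB⟩ := exists_deep_center hS (k := k) (by
    rw [mul_comm]; exact (Nat.le_div_iff_mul_le (by omega)).1 hk)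
  have h := isDeep_heightOne hd hS hc hcB
  exact (h.le_card_facetsLE (by simp [finrank_prod]; omega)).trans
    (card_facetsLE_le_numFacetsLE hd hS h)

/-! ### Perturbation into general position -/

/-- A family of points on the moment curve. -/
noncomputable def momentCurve (d n : ℕ) (i : Fin n) : EuclideanSpace ℝ (Fin d) :=
  WithLp.toLp 2 fun j => ((i : ℕ) : ℝ) ^ ((j : ℕ) + 1)

/-- The matrix whose rows are the given points, each preceded by a coordinate `1`. -/
def homogenizedMatrix {d : ℕ} (p : Fin (d + 1) → EuclideanSpace ℝ (Fin d)) :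
    Matrix (Fin (d + 1)) (Fin (d + 1)) ℝ :=
  Matrix.of fun i => Fin.cons 1 fun j => p i j

theorem affineIndependent_of_det_ne_zero {d : ℕ} {p : Fin (d + 1) → EuclideanSpace ℝ (Fin d)}
    (h : (homogenizedMatrix p).det ≠ 0) : AffineIndependent ℝ p := by
  have hli := Matrix.linearIndependent_rows_of_det_ne_zero h
  rw [affineIndependent_iff]
  intro s w hw hp
  rw [linearIndependent_iff'] at hli
  refine hli s w ?_
  ext j
  refine Fin.cases ?_ (fun j => ?_) j
  · simpa [homogenizedMatrix, Matrix.row] using hw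
  · have := congrArg (fun z : EuclideanSpace ℝ (Fin d) => z j) hp
    simpa [homogenizedMatrix, Matrix.row] using this

theorem det_homogenizedMatrix_momentCurve_ne_zero {d n : ℕ} {e : Fin (d + 1) → Fin n}
    (he : Function.Injective e) :
    (homogenizedMatrix fun i => momentCurve d n (e i)).det ≠ 0 := by
  have : (homogenizedMatrix fun i => momentCurve d n (e i)) =
      Matrix.vandermonde fun i => ((e i : ℕ) : ℝ) := by
    ext i j
    refine Fin.cases ?_ (fun j => ?_) j
    · simp [homogenizedMatrix, Matrix.vandermonde_apply]
    · simp [homogenizedMatrix, Matrix.vandermonde_apply, momentCurve]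
  rw [this, Matrix.det_vandermonde_ne_zero_iff]
  intro i j hij
  exact he (Fin.ext (Nat.cast_injective (R := ℝ) hij))

/-- Moving every point of a family a little towards the corresponding point of the moment curve
brings it into general position: the determinants concerned are nonzero polynomials in the length
of the step, as they do not vanish when the moment curve is reached. -/
theorem eventually_affineIndependent {d n : ℕ} (y : Fin n → EuclideanSpace ℝ (Fin d)) :
    ∀ᶠ ε : ℝ in 𝓝[≠] 0, ∀ T : Finset (Fin n), T.card = d + 1 →
      AffineIndependent ℝ fun i : T => y i + ε • (momentCurve d n i - y i) := by
  rw [Filter.eventually_all]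
  intro T
  by_cases hT : T.card = d + 1
  swap
  · exact Filter.Eventually.of_forall fun ε h => absurd h hT
  let e : T ≃ Fin (d + 1) := Finset.equivFinOfCardEq hT
  let A := homogenizedMatrix fun i => y (e.symm i)
  let B := homogenizedMatrix fun i => momentCurve d n (e.symm i)
  let p : Polynomial ℝ := (A.map Polynomial.C + (Polynomial.X : Polynomial ℝ) •
    (B - A).map Polynomial.C).det
  have hp : ∀ ε : ℝ, p.eval ε =
      (homogenizedMatrix fun i => y (e.symm i) +
        ε • (momentCurve d n (e.symm i) - y (e.symm i))).det := by
    intro ε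
    rw [← Polynomial.coe_evalRingHom, RingHom.map_det]
    congr 1
    ext i j
    refine Fin.cases ?_ (fun j => ?_) j
    · simp [A, B, homogenizedMatrix]
    · simp [A, B, homogenizedMatrix]
  have hp0 : p ≠ 0 := by
    intro h0
    have h1 := hp 1
    rw [h0, Polynomial.eval_zero] at h1
    simp only [one_smul, add_sub_cancel] at h1
    exact det_homogenizedMatrix_momentCurve_ne_zero
      (Subtype.val_injective.comp e.symm.injective) h1.symm
  have hfin : ({ε | p.IsRoot ε} \ {0} : Set ℝ).Finite :=
    (Polynomial.finite_setOfPred_isRoot hp0).subset Set.sdiff_subset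
  filter_upwards [nhdsWithin_le_nhds (hfin.isClosed.isOpen_compl.mem_nhds (by simp)),
    self_mem_nhdsWithin] with ε hε hε0 _
  have hdet : p.eval ε ≠ 0 := fun h => hε ⟨h, hε0⟩
  rw [hp] at hdet
  have := (affineIndependent_equiv e).2 (affineIndependent_of_det_ne_zero hdet)
  simpa [Function.comp_def] using this

theorem injective_of_affineIndependent {d n : ℕ} (hd : 1 ≤ d) (hn : d + 1 ≤ n)
    {y : Fin n → EuclideanSpace ℝ (Fin d)}
    (hy : ∀ T : Finset (Fin n), T.card = d + 1 → AffineIndependent ℝ fun i : T => y i) :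
    Function.Injective y := by
  intro i j hij
  obtain ⟨T, hT, hTc⟩ := Finset.exists_superset_card_eq (s := {i, j}) (n := d + 1)
    (Finset.card_le_two.trans (by omega)) (by simpa using hn)
  have := (hy T hTc).injective (a₁ := ⟨i, hT (by simp)⟩) (a₂ := ⟨j, hT (by simp)⟩) hij
  simpa using this

theorem generalPosition_image {d n : ℕ} (hn : d + 1 ≤ n) {y : Fin n → EuclideanSpace ℝ (Fin d)}
    [DecidableEq (EuclideanSpace ℝ (Fin d))] (hinj : Function.Injective y)
    (hy : ∀ T : Finset (Fin n), T.card = d + 1 → AffineIndependent ℝ fun i : T => y i) :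
    GeneralPosition (Finset.univ.image y) := by
  intro T hT hTc
  obtain ⟨T', rfl⟩ := Finset.subset_univ_image_iff.1 hT
  rw [Finset.card_image_of_injective _ hinj] at hTc
  obtain ⟨U, hU, hUc⟩ := Finset.exists_superset_card_eq hTc (by simpa using hn)
  refine (hy U hUc).range.mono fun x hx => ?_
  obtain ⟨i, hi, rfl⟩ := Finset.mem_image.1 (Finset.mem_coe.1 hx)
  exact ⟨⟨i, hU hi⟩, rfl⟩

/-! ### Points on rays -/

/-- The directions of the `d + 1` rays: the standard basis vectors and minus their sum. -/
noncomputable def rayDir (d : ℕ) (j : Fin (d + 1)) : EuclideanSpace ℝ (Fin d) :=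
  Fin.lastCases (-∑ i, EuclideanSpace.single i (1 : ℝ)) (fun i => EuclideanSpace.single i (1 : ℝ)) j

theorem exists_inner_rayDir_pos {d : ℕ} {u : EuclideanSpace ℝ (Fin d)} (hu : u ≠ 0) :
    ∃ j, 0 < inner ℝ u (rayDir d j) := by
  by_contra! hall
  have h1 : ∀ i, inner ℝ u (rayDir d (Fin.castSucc i)) = u i := by
    intro i; simp [rayDir, EuclideanSpace.inner_single_right]
  have h2 : inner ℝ u (rayDir d (Fin.last d)) = -∑ i, u i := by
    simp [rayDir, inner_sum, EuclideanSpace.inner_single_right]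
  have h3 := hall (Fin.last d)
  have h4 : ∀ i, u i ≤ 0 := fun i => h1 i ▸ hall _
  rw [h2, neg_nonpos] at h3
  have h5 := (Finset.sum_eq_zero_iff_of_nonpos fun i _ => h4 i).1
    (le_antisymm (Finset.sum_nonpos fun i _ => h4 i) h3)
  exact hu (by ext i; simpa using h5 i (Finset.mem_univ i))

/-- The ray to which the point with index `i` belongs. -/
def rayOf (d : ℕ) {n : ℕ} (i : Fin n) : Fin (d + 1) := ⟨i % (d + 1), Nat.mod_lt _ d.succ_pos⟩

/-- The position of the point with index `i` on its ray, counted from the outside. -/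
def posOf (d : ℕ) {n : ℕ} (i : Fin n) : ℕ := i / (d + 1)

theorem eq_of_rayOf_eq {d n : ℕ} {i j : Fin n} (h : rayOf d i = rayOf d j)
    (h' : posOf d i = posOf d j) : i = j := by
  have h1 : (i : ℕ) % (d + 1) = j % (d + 1) := congrArg Fin.val h
  have h2 : (i : ℕ) / (d + 1) = j / (d + 1) := h'
  ext
  rw [← Nat.div_add_mod (i : ℕ) (d + 1), ← Nat.div_add_mod (j : ℕ) (d + 1), h1, h2]

/-- Points on `d + 1` rays which emanate from the origin. -/
noncomputable def rayPoint (d n : ℕ) (i : Fin n) : EuclideanSpace ℝ (Fin d) :=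
  ((n : ℝ) - posOf d i) • rayDir d (rayOf d i)

theorem posOf_lt {d n : ℕ} (i : Fin n) : posOf d i < n :=
  (Nat.div_le_self _ _).trans_lt i.2

theorem exists_rayOf_eq {d n l : ℕ} {j : Fin (d + 1)} (h : l * (d + 1) + j < n) :
    ∃ i : Fin n, rayOf d i = j ∧ posOf d i = l := by
  refine ⟨⟨l * (d + 1) + j, h⟩, ?_, ?_⟩
  · ext
    simp [rayOf, Nat.mod_eq_of_lt j.2]
  · change (l * (d + 1) + j) / (d + 1) = l
    rw [mul_comm, Nat.mul_add_div d.succ_pos, Nat.div_eq_of_lt j.2, add_zero]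

theorem le_card_rayOf_eq {d n : ℕ} (j : Fin (d + 1)) :
    n / (d + 1) ≤ (Finset.univ.filter fun i : Fin n => rayOf d i = j).card := by
  rw [← Finset.card_range (n / (d + 1))]
  refine Finset.card_le_card_of_surjOn (posOf d) fun l hl => ?_
  rw [Finset.coe_range, Set.mem_Iio] at hl
  have h1 : (l + 1) * (d + 1) ≤ n / (d + 1) * (d + 1) := Nat.mul_le_mul_right _ hl
  have h2 := Nat.div_mul_le_self n (d + 1)
  have h3 := j.2
  rw [add_mul, one_mul] at h1
  obtain ⟨i, hij, hil⟩ := exists_rayOf_eq (show l * (d + 1) + j < n by omega)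
  exact ⟨i, by simpa using hij, hil⟩

/-- The points of the family `y` on the positive side of the hyperplane through the points indexed
by `σ` that has the normal vector `u`. -/
noncomputable def indicesAbove {d n : ℕ} (y : Fin n → EuclideanSpace ℝ (Fin d)) (σ : Finset (Fin n))
    (u : EuclideanSpace ℝ (Fin d)) : Finset (Fin n) :=
  open Classical in Finset.univ.filter fun i => ∀ a ∈ σ, 0 < inner ℝ u (y i - y a)

/-- The alternative for an oriented hyperplane `(σ, u)`: it has many points on its positive side, or
it separates the origin from all points that lie further out than those of `σ` on their rays, and
contains no two points of the same ray. -/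
def ManyAboveOrTransversal {d n : ℕ} (y : Fin n → EuclideanSpace ℝ (Fin d)) (σ : Finset (Fin n))
    (u : EuclideanSpace ℝ (Fin d)) : Prop :=
  n / (d + 1) ≤ (indicesAbove y σ u).card ∨ Set.InjOn (rayOf d) (σ : Set (Fin n)) ∧
    (∀ a ∈ σ, ∀ i, rayOf d i = rayOf d a → posOf d i < posOf d a → i ∈ indicesAbove y σ u) ∧
    ∀ a ∈ σ, 0 < inner ℝ u (y a)

theorem manyAboveOrTransversal_rayPoint {d n : ℕ} {σ : Finset (Fin n)} (hσ : σ.Nonempty)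
    {u : EuclideanSpace ℝ (Fin d)} (hu : u ≠ 0)
    (huσ : ∀ a ∈ σ, ∀ b ∈ σ, inner ℝ u (rayPoint d n b - rayPoint d n a) = 0) :
    ManyAboveOrTransversal (rayPoint d n) σ u := by
  classical
  obtain ⟨a₀, ha₀⟩ := hσ
  have hval : ∀ i : Fin n, inner ℝ u (rayPoint d n i) =
      ((n : ℝ) - posOf d i) * inner ℝ u (rayDir d (rayOf d i)) := fun i => by
    rw [rayPoint, real_inner_smul_right]
  have hpos : ∀ i : Fin n, (0 : ℝ) < n - posOf d i := fun i => by
    rw [sub_pos]; exact_mod_cast posOf_lt i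
  have hconst : ∀ a ∈ σ, inner ℝ u (rayPoint d n a) = inner ℝ u (rayPoint d n a₀) := fun a ha => by
    have := huσ a₀ ha₀ a ha
    rw [inner_sub_right] at this
    linarith
  have hmem : ∀ i, i ∈ indicesAbove (rayPoint d n) σ u ↔
      inner ℝ u (rayPoint d n a₀) < inner ℝ u (rayPoint d n i) := by
    intro i
    simp only [indicesAbove, Finset.mem_filter, Finset.mem_univ, true_and, inner_sub_right, sub_pos]
    exact ⟨fun h => h a₀ ha₀, fun h a ha => (hconst a ha).trans_lt h⟩
  rcases le_or_gt (inner ℝ u (rayPoint d n a₀)) 0 with h0 | h0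
  · -- a whole ray lies on the positive side
    left
    obtain ⟨j, hj⟩ := exists_inner_rayDir_pos hu
    refine (le_card_rayOf_eq j).trans (Finset.card_le_card fun i hi => ?_)
    rw [hmem]
    rw [Finset.mem_filter] at hi
    refine h0.trans_lt ?_
    rw [hval, hi.2]
    exact mul_pos (hpos i) hj
  · right
    have hdir : ∀ a ∈ σ, 0 < inner ℝ u (rayDir d (rayOf d a)) := fun a ha => by
      have := hconst a ha
      rw [hval] at this
      exact (mul_pos_iff_of_pos_left (hpos a)).1 (this ▸ h0)
    refine ⟨fun a ha b hb hab => eq_of_rayOf_eq hab ?_, fun a ha i hi hia => ?_,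
      fun a ha => (hconst a ha).symm ▸ h0⟩
    · have h1 := (hconst a ha).trans (hconst b hb).symm
      rw [hval, hval, hab] at h1
      have h2 := mul_right_cancel₀ (hdir b hb).ne' h1
      exact_mod_cast (sub_right_inj.1 h2)
    · rw [hmem, ← hconst a ha, hval, hval, hi]
      refine mul_lt_mul_of_pos_right (sub_lt_sub_left ?_ _) (hdir a ha)
      exact_mod_cast hia

/-- The alternative is stable under small perturbations of the points, by compactness of the unit
sphere. -/
theorem eventually_manyAboveOrTransversal (d n : ℕ) :
    ∀ᶠ y in 𝓝 (rayPoint d n), ∀ σ : Finset (Fin n), σ.Nonempty →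
      ∀ u ∈ Metric.sphere (0 : EuclideanSpace ℝ (Fin d)) 1,
        (∀ a ∈ σ, ∀ b ∈ σ, inner ℝ u (y b - y a) = 0) → ManyAboveOrTransversal y σ u := by
  classical
  rw [Filter.eventually_all]
  intro σ
  by_cases hσ : σ.Nonempty
  swap
  · exact Filter.Eventually.of_forall fun y h => absurd h hσ
  suffices h : ∀ᶠ y in 𝓝 (rayPoint d n), ∀ u ∈ Metric.sphere (0 : EuclideanSpace ℝ (Fin d)) 1,
      (∀ a ∈ σ, ∀ b ∈ σ, inner ℝ u (y b - y a) = 0) → ManyAboveOrTransversal y σ u by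
    filter_upwards [h] with y hy _ using hy
  refine (isCompact_sphere _ _).eventually_forall_of_forall_eventually fun u hu => ?_
  have hu0 : u ≠ 0 := by
    rintro rfl
    simp at hu
  have hcont : ∀ i a : Fin n, Continuous fun z : (Fin n → EuclideanSpace ℝ (Fin d)) ×
      EuclideanSpace ℝ (Fin d) => inner ℝ z.2 (z.1 i - z.1 a) := fun i a => by fun_prop
  have hcont' : ∀ a : Fin n, Continuous fun z : (Fin n → EuclideanSpace ℝ (Fin d)) ×
      EuclideanSpace ℝ (Fin d) => inner ℝ z.2 (z.1 a) := fun a => by fun_prop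
  by_cases huσ : ∀ a ∈ σ, ∀ b ∈ σ, inner ℝ u (rayPoint d n b - rayPoint d n a) = 0
  · have hsub : ∀ᶠ z in 𝓝 (rayPoint d n, u),
        indicesAbove (rayPoint d n) σ u ⊆ indicesAbove z.1 σ z.2 := by
      have : ∀ᶠ z in 𝓝 (rayPoint d n, u), ∀ i a : Fin n,
          0 < inner ℝ u (rayPoint d n i - rayPoint d n a) → 0 < inner ℝ z.2 (z.1 i - z.1 a) := by
        rw [Filter.eventually_all]
        intro i
        rw [Filter.eventually_all]
        intro a
        by_cases h : 0 < inner ℝ u (rayPoint d n i - rayPoint d n a)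
        · filter_upwards [(hcont i a).continuousAt.eventually (lt_mem_nhds h)] with z hz _ using hz
        · exact Filter.Eventually.of_forall fun z h' => absurd h' h
      filter_upwards [this] with z hz i hi
      simp only [indicesAbove, Finset.mem_filter, Finset.mem_univ, true_and] at hi ⊢
      exact fun a ha => hz i a (hi a ha)
    have hsep : ∀ᶠ z in 𝓝 (rayPoint d n, u), ∀ a : Fin n, 0 < inner ℝ u (rayPoint d n a) →
        0 < inner ℝ z.2 (z.1 a) := by
      rw [Filter.eventually_all]
      intro a
      by_cases h : 0 < inner ℝ u (rayPoint d n a)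
      · filter_upwards [(hcont' a).continuousAt.eventually (lt_mem_nhds h)] with z hz _ using hz
      · exact Filter.Eventually.of_forall fun z h' => absurd h' h
    filter_upwards [hsub, hsep] with z hz hz' _
    rcases manyAboveOrTransversal_rayPoint hσ hu0 huσ with h | ⟨h1, h2, h3⟩
    · exact Or.inl (h.trans (Finset.card_le_card hz))
    · exact Or.inr ⟨h1, fun a ha i hi hia => hz (h2 a ha i hi hia), fun a ha => hz' a (h3 a ha)⟩
  · push Not at huσ
    obtain ⟨a, ha, b, hb, hab⟩ := huσ
    filter_upwards [(hcont b a).continuousAt.eventually_ne hab] with z hz h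
    exact absurd (h a ha b hb) hz

theorem exists_perturbation {d n : ℕ} :
    ∃ y : Fin n → EuclideanSpace ℝ (Fin d),
      (∀ T : Finset (Fin n), T.card = d + 1 → AffineIndependent ℝ fun i : T => y i) ∧
      ∀ σ : Finset (Fin n), σ.Nonempty → ∀ u : EuclideanSpace ℝ (Fin d), ‖u‖ = 1 →
        (∀ a ∈ σ, ∀ b ∈ σ, inner ℝ u (y b - y a) = 0) → ManyAboveOrTransversal y σ u := by
  have hcont : Filter.Tendsto
      (fun ε : ℝ => fun i => rayPoint d n i + ε • (momentCurve d n i - rayPoint d n i))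
      (𝓝[≠] 0) (𝓝 (rayPoint d n)) := by
    refine tendsto_pi_nhds.2 fun i => ?_
    generalize momentCurve d n i - rayPoint d n i = v
    generalize rayPoint d n i = x
    have h : Continuous fun ε : ℝ => x + ε • v := by fun_prop
    simpa using (h.tendsto 0).mono_left (nhdsWithin_le_nhds (s := {0}ᶜ))
  obtain ⟨ε, h1, h2⟩ := ((eventually_affineIndependent (rayPoint d n)).and
    (hcont.eventually (eventually_manyAboveOrTransversal d n))).exists
  refine ⟨fun i => rayPoint d n i + ε • (momentCurve d n i - rayPoint d n i), h1,
    fun σ hσ u hu => h2 σ hσ u ?_⟩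
  rwa [mem_sphere_zero_iff_norm]

/-- The transversal sets `σ` of `d` points with total position at most `k`: such a set is determined
by the ray it misses and by the positions on the other rays. -/
theorem card_transversals_le (d n k : ℕ) :
    open Classical in
    ((Finset.univ.powersetCard d).filter fun σ : Finset (Fin n) =>
      Set.InjOn (rayOf d) (σ : Set (Fin n)) ∧ ∑ a ∈ σ, posOf d a ≤ k).card ≤
      (d + 1) * (k + d).choose d := by
  classical
  let D := (Finset.univ : Finset (Fin (d + 1))) ×ˢ
    (Finset.univ : Finset (Fin (d + 1))).finsuppAntidiag k
  let G : Fin (d + 1) × (Fin (d + 1) →₀ ℕ) → Finset (Fin n) := fun x =>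
    Finset.univ.filter fun i => rayOf d i ≠ x.1 ∧ posOf d i = x.2 (rayOf d i)
  have hD : D.card = (d + 1) * (k + d).choose d := by
    rw [Finset.card_product, Finset.card_finsuppAntidiag_nat_eq_choose, Finset.card_fin,
      show d + 1 + k - 1 = d + k by omega, add_comm k d, ← Nat.choose_symm_add]
  rw [← hD]
  refine (Finset.card_le_card fun σ hσ => ?_).trans (Finset.card_image_le (f := G))
  rw [Finset.mem_filter, Finset.mem_powersetCard] at hσ
  obtain ⟨⟨-, hσd⟩, hinj, hk⟩ := hσ
  have himg : (σ.image (rayOf d)).card = d := by rw [Finset.card_image_of_injOn hinj, hσd]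
  obtain ⟨j, hj⟩ : ∃ j, (σ.image (rayOf d))ᶜ = {j} := by
    rw [← Finset.card_eq_one, Finset.card_compl, himg, Fintype.card_fin]
    omega
  have hjm : ∀ r, r ∈ σ.image (rayOf d) ↔ r ≠ j := fun r => by
    rw [ne_eq, ← Finset.mem_singleton, ← hj, Finset.mem_compl, not_not]
  -- the unused part of `k` is recorded at the missing ray
  let h : Fin (d + 1) → ℕ := fun r => if r = j then k - ∑ a ∈ σ, posOf d a else
    ∑ a ∈ σ.filter (fun a => rayOf d a = r), posOf d a
  have hh : ∀ a ∈ σ, h (rayOf d a) = posOf d a := by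
    intro a ha
    have hne : rayOf d a ≠ j := (hjm _).1 (Finset.mem_image_of_mem _ ha)
    simp only [h, if_neg hne]
    have : σ.filter (fun b => rayOf d b = rayOf d a) = {a} := by
      ext b
      rw [Finset.mem_filter, Finset.mem_singleton]
      exact ⟨fun hb => hinj hb.1 ha hb.2, by rintro rfl; exact ⟨ha, rfl⟩⟩
    rw [this, Finset.sum_singleton]
  have hsum : ∑ r, h r = k := by
    have h1 : ∑ r ∈ σ.image (rayOf d), h r = ∑ a ∈ σ, posOf d a := by
      rw [Finset.sum_image hinj]
      exact Finset.sum_congr rfl hh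
    rw [← Finset.sum_add_sum_compl (σ.image (rayOf d)), h1, hj, Finset.sum_singleton]
    simp only [h, if_true]
    omega
  refine Finset.mem_image.2 ⟨(j, Finsupp.equivFunOnFinite.symm h), ?_, ?_⟩
  · simp [D, Finset.mem_finsuppAntidiag, hsum]
  · ext i
    simp only [G, Finset.mem_filter, Finset.mem_univ, true_and, Finsupp.equivFunOnFinite_symm_apply_apply]
    constructor
    · rintro ⟨hij, hi⟩
      obtain ⟨a, ha, hai⟩ := Finset.mem_image.1 ((hjm _).2 hij)
      rw [← hai, hh a ha] at hi
      rwa [eq_of_rayOf_eq hai.symm hi]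
    · intro hi
      exact ⟨(hjm _).1 (Finset.mem_image_of_mem _ hi), (hh i hi).symm⟩

theorem sum_posOf_le_card {d n : ℕ} {σ P : Finset (Fin n)}
    (hinj : Set.InjOn (rayOf d) (σ : Set (Fin n)))
    (hP : ∀ a ∈ σ, ∀ i, rayOf d i = rayOf d a → posOf d i < posOf d a → i ∈ P) :
    ∑ a ∈ σ, posOf d a ≤ P.card := by
  classical
  have hfib : ∀ a ∈ σ, posOf d a ≤ (P.filter fun i => rayOf d i = rayOf d a).card := by
    intro a ha
    rw [← Finset.card_range (posOf d a)]
    refine Finset.card_le_card_of_surjOn (posOf d) fun l hl => ?_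
    rw [Finset.coe_range, Set.mem_Iio] at hl
    have h1 : l * (d + 1) ≤ posOf d a * (d + 1) := Nat.mul_le_mul_right _ hl.le
    have h2 : (d + 1) * posOf d a + rayOf d a = (a : ℕ) := Nat.div_add_mod _ _
    have h3 := a.2
    rw [mul_comm (d + 1)] at h2
    obtain ⟨i, hia, hil⟩ := exists_rayOf_eq (show l * (d + 1) + rayOf d a < n by omega)
    exact ⟨i, by simpa using ⟨hP a ha i hia (hil.trans_lt hl), hia⟩, hil⟩
  refine (Finset.sum_le_sum hfib).trans ?_
  rw [← Finset.card_biUnion]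
  · exact Finset.card_le_card (Finset.biUnion_subset.2 fun a _ => Finset.filter_subset _ _)
  · intro a ha b hb hab
    rw [Function.onFun, Finset.disjoint_left]
    intro i hi hi'
    rw [Finset.mem_filter] at hi hi'
    exact hab (hinj ha hb (hi.2.symm.trans hi'.2))

/-! ### Tightness -/

theorem numFacetsLE_le {d : ℕ} (hd : 1 ≤ d) {n : ℕ} {y : Fin n → EuclideanSpace ℝ (Fin d)}
    [DecidableEq (EuclideanSpace ℝ (Fin d))] (hinj : Function.Injective y)
    (hgen : GeneralPosition (Finset.univ.image y))
    (hy : ∀ σ : Finset (Fin n), σ.Nonempty → ∀ u : EuclideanSpace ℝ (Fin d), ‖u‖ = 1 →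
      (∀ a ∈ σ, ∀ b ∈ σ, inner ℝ u (y b - y a) = 0) → ManyAboveOrTransversal y σ u)
    {k : ℕ} (hk : k < n / (d + 1)) :
    numFacetsLE (Finset.univ.image y) k ≤ (d + 1) * (k + d).choose d := by
  classical
  refine le_trans ?_ (card_transversals_le d n k)
  rw [numFacetsLE_eq_ncard hd hgen, ← Set.ncard_coe_finset]
  let ind : Finset (EuclideanSpace ℝ (Fin d)) → Finset (Fin n) := fun τ =>
    Finset.univ.filter fun i => y i ∈ τ
  have himage : ∀ τ ⊆ Finset.univ.image y, (ind τ).image y = τ := by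
    intro τ hτ
    ext x
    simp only [ind, Finset.mem_image, Finset.mem_filter, Finset.mem_univ, true_and]
    constructor
    · rintro ⟨i, hi, rfl⟩; exact hi
    · intro hx
      obtain ⟨i, -, rfl⟩ := Finset.mem_image.1 (hτ hx)
      exact ⟨i, hx, rfl⟩
  -- with so few points above it, a facet is transversal to the rays
  have key : ∀ F ∈ kFacetsLE (Finset.univ.image y) k, (ind F.1).card = d ∧
      (indicesAbove y (ind F.1) F.2).card ≤ k ∧ Set.InjOn (rayOf d) (ind F.1 : Set (Fin n)) ∧
      (∀ a ∈ ind F.1, ∀ i, rayOf d i = rayOf d a → posOf d i < posOf d a →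
        i ∈ indicesAbove y (ind F.1) F.2) ∧ ∀ a ∈ ind F.1, 0 < inner ℝ F.2 (y a) := by
    rintro ⟨τ, u⟩ ⟨hτ, hτd, hu, hτk⟩
    simp only at hτ hτd hu hτk ⊢
    have hcard : (ind τ).card = d := by
      rw [← hτd, ← Finset.card_image_of_injective _ hinj, himage τ hτ]
    have habove : ((Finset.univ.image y : Finset _) : Set (EuclideanSpace ℝ (Fin d))) ∩
        positiveSide τ u = y '' (indicesAbove y (ind τ) u : Set (Fin n)) := by
      ext x
      simp only [Finset.coe_image, Finset.coe_univ, Set.image_univ, Set.mem_inter_iff,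
        Set.mem_range, positiveSide, Set.mem_ofPred_eq, indicesAbove, Finset.coe_filter,
        Finset.mem_univ, true_and, Set.mem_image]
      constructor
      · rintro ⟨⟨i, rfl⟩, hi⟩
        exact ⟨i, fun a ha => hi _ (Finset.mem_filter.1 ha).2, rfl⟩
      · rintro ⟨i, hi, rfl⟩
        refine ⟨⟨i, rfl⟩, fun x hx => ?_⟩
        obtain ⟨a, -, rfl⟩ := Finset.mem_image.1 (hτ hx)
        exact hi a (by simpa [ind] using hx)
    rw [habove, Set.ncard_image_of_injective _ hinj, Set.ncard_coe_finset] at hτk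
    refine ⟨hcard, hτk, ?_⟩
    refine (hy (ind τ) (Finset.card_pos.1 (by omega)) u hu.1 fun a ha b hb =>
      hu.2 _ (Finset.mem_filter.1 ha).2 _ (Finset.mem_filter.1 hb).2).resolve_left ?_
    omega
  refine Set.ncard_le_ncard_of_injOn (fun F => ind F.1) ?_ ?_ (Finset.finite_toSet _)
  · intro F hF
    obtain ⟨h1, h2, h3, h4, -⟩ := key F hF
    rw [Finset.mem_coe, Finset.mem_filter, Finset.mem_powersetCard]
    exact ⟨⟨Finset.subset_univ _, h1⟩, h3, (sum_posOf_le_card h3 h4).trans h2⟩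
  · rintro ⟨τ, u⟩ hF ⟨τ', u'⟩ hF' h
    have hττ : τ = τ' := by
      rw [← himage τ hF.1, ← himage τ' hF'.1]
      exact congrArg (Finset.image y) h
    subst hττ
    obtain ⟨h1, -, -, -, h5⟩ := key _ hF
    obtain ⟨-, -, -, -, h5'⟩ := key _ hF'
    obtain ⟨a, ha⟩ : (ind τ).Nonempty := Finset.card_pos.1 (by simp only at h1; omega)
    rcases IsUnitNormal.eq_or_eq_neg (hgen τ hF.1 (by have := hF.2.1; simp only at this; omega)) hd
      hF.2.1 hF.2.2.1 hF'.2.2.1 with h | h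
    · simp only at h
      rw [h]
    · -- only the normal vector that points away from the origin is possible
      have p1 := h5 a ha
      have p2 := h5' a ha
      simp only at h p1 p2
      rw [h, inner_neg_left] at p2
      linarith

theorem theorem4 (d : ℕ) (hd : 1 ≤ d) (n : ℕ) (hn : d + 1 ≤ n) :
    (∀ S : Finset (EuclideanSpace ℝ (Fin d)), GeneralPosition S → S.card = n →
      ∀ k : ℕ, k < n / (d + 1) → (d + 1) * (k + d).choose d ≤ numFacetsLE S k) ∧
    (∃ S : Finset (EuclideanSpace ℝ (Fin d)), GeneralPosition S ∧ S.card = n ∧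
      ∀ k : ℕ, k < n / (d + 1) → numFacetsLE S k = (d + 1) * (k + d).choose d) := by
  classical
  refine ⟨fun S hS hSn k hk => le_numFacetsLE hd hS (hSn ▸ hk), ?_⟩
  obtain ⟨y, hy, hy'⟩ := exists_perturbation (d := d) (n := n)
  have hinj := injective_of_affineIndependent hd hn hy
  have hgen := generalPosition_image hn hinj hy
  have hcard : (Finset.univ.image y).card = n := by
    rw [Finset.card_image_of_injective _ hinj, Finset.card_fin]
  exact ⟨Finset.univ.image y, hgen, hcard, fun k hk => le_antisymm
    (numFacetsLE_le hd hinj hgen hy' hk) (le_numFacetsLE hd hgen (hcard.symm ▸ hk))⟩
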